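/- Let $k\ge 2$ be an integer, $\epsilon>0$ a real number, $m$ a nonnegative integer, and put $$\delta(\alpha,m)=\Bigl(1-\tfrac1m+\sqrt{\alpha-\tfrac1m\bigl(1-\tfrac1m\bigr)}\Bigr)^2$$ (for $m=0$ read $\tfrac1m$ as $0$, and read the square root of a negative number as $0$; neither convention plays a role when $m\ge 1$ and the hypotheses in 1 hold for a nonconstant polynomial, or those in 2 hold with $d\ge 1$). A homogeneous polynomial $h\in\mathbb R[x_1,\dots,x_n]$ is *hyperbolic* with respect to $\mathbf e\in\mathbb R^n$ if $h(\mathbf e)\ne 0$ and for every $\mathbf x\in\mathbb R^n$ the univariate polynomial $t\mapsto h(t\mathbf e-\mathbf x)$ has only real zeros. Its zeros $\lambda_1(\mathbf x),\dots,\lambda_d(\mathbf x)$ ($d=\deg h$, counted with multiplicity) are the *eigenvalues* of $\mathbf x$. The closed hyperbolicity cone $\Lambda_+$ is the set of all $\mathbf x$ whose eigenvalues are all nonnegative; $\operatorname{tr}(\mathbf x)=\sum_i\lambda_i(\mathbf x)$, $\operatorname{rk}(\mathbf x)=\#\{i:\lambda_i(\mathbf x)\ne0\}$, and $\|\mathbf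 x\|=\max_i|\lambda_i(\mathbf x)|$ (which is $0$ if $d=0$). A partition $S_1\cup\dots\cup S_k=[m]=\{1,\dots,m\}$ means pairwise disjoint, possibly empty sets with union $[m]$. 1. Suppose $h$ is hyperbolic with respect to $\mathbf e\in\mathbb R^n$, and $\mathbf u_1,\dots,\mathbf u_m\in\Lambda_+$ satisfy $\operatorname{rk}(\mathbf u_i)\le1$ and $\operatorname{tr}(\mathbf u_i)\le\epsilon$ for all $i$, and $\mathbf u_1+\dots+\mathbf u_m=\mathbf e$. Then there is a partition $S_1\cup\dots\cup S_k=[m]$ such that for every $j\in[k]$ $$\Bigl\|\sum_{i\in S_j}\mathbf u_i\Bigr\|\le\frac1k\,\delta(k\epsilon,m).$$ 2. In particular (the case $h=\det$, which sharpens the Marcus–Spielman–Srivastava theorem): if $v_1,\dots,v_m\in\mathbb C^d$ satisfy $\sum_{i=1}^m v_iv_i^*=I$ and $\|v_i\|^2\le\epsilon$ for all $i$, then there is a partition $S_1\cup\dots\cup S_k=[m]$ such that for every $j\in[k]$, in operator norm, $$\Bigl\|\sum_{i\in S_j}v_iv_i^*\Bigr\|\le\frac1k\,\delta(k\epsilon,m).$$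 3. For $m\ge1$ one has $\delta(k\epsilon,m)<(1+\sqrt{k\epsilon})^2$, so the bound in 2 is strictly smaller than the bound $\frac1k(1+\sqrt{k\epsilon})^2$ of the Marcus–Spielman–Srivastava theorem. -/

import Mathlib

namespace HyperbolicMSS

/-- The univariate real polynomial `t ↦ h(t e - x)`. -/
noncomputable def linePoly {σ : Type*} (h : MvPolynomial σ ℝ) (e x : σ → ℝ) : Polynomial ℝ :=
  MvPolynomial.aeval
    (fun i => Polynomial.X * Polynomial.C (e i) - Polynomial.C (x i)) h

/-- A real polynomial `h` is hyperbolic with respect to `e` if it is homogeneous, `h(e) ≠ 0`, and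
for every real vector `x` all complex zeros of `t ↦ h(t e - x)` are real. -/
structure IsHyperbolic {σ : Type*} (h : MvPolynomial σ ℝ) (e : σ → ℝ) : Prop where
  homogeneous : ∃ d : ℕ, h.IsHomogeneous d
  eval_ne_zero : MvPolynomial.eval e h ≠ 0
  real_rooted : ∀ (x : σ → ℝ) (z : ℂ), Polynomial.aeval z (linePoly h e x) = 0 → z.im = 0

/-- The eigenvalues of `x` with respect to `e`: the zeros of `t ↦ h(t e - x)`, with
multiplicity. -/
noncomputable def eigenvalues {σ : Type*} (h : MvPolynomial σ ℝ) (e x : σ → ℝ) : Multiset ℝ :=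
  (linePoly h e x).roots

/-- The closed hyperbolicity cone: the vectors whose smallest eigenvalue is nonnegative. -/
def closedCone {σ : Type*} (h : MvPolynomial σ ℝ) (e : σ → ℝ) : Set (σ → ℝ) :=
  {x | ∀ r ∈ eigenvalues h e x, 0 ≤ r}

/-- The trace: the sum of the eigenvalues. -/
noncomputable def trace {σ : Type*} (h : MvPolynomial σ ℝ) (e x : σ → ℝ) : ℝ :=
  (eigenvalues h e x).sum

/-- The rank: the number of nonzero eigenvalues, with multiplicity. -/
noncomputable def rank {σ : Type*} (h : MvPolynomial σ ℝ) (e x : σ → ℝ) : ℕ :=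
  ((eigenvalues h e x).filter (fun r => r ≠ 0)).card

/-- The spectral radius: the largest absolute value of an eigenvalue (`0` if there are no
eigenvalues, that is, if `h` is constant). -/
noncomputable def specRadius {σ : Type*} (h : MvPolynomial σ ℝ) (e x : σ → ℝ) : ℝ :=
  (((eigenvalues h e x).map (fun r => ‖r‖₊)).sup : NNReal)

/-- `δ(α, m) = (1 - 1/m + √(α - (1/m)(1 - 1/m)))²`. -/
noncomputable def delta (α : ℝ) (m : ℕ) : ℝ :=
  (1 - 1 / (m : ℝ) + Real.sqrt (α - 1 / (m : ℝ) * (1 - 1 / (m : ℝ)))) ^ 2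

/-- `S 0, …, S (k-1)` is a partition of `{0, …, m-1}` into `k` labelled, possibly empty, parts. -/
def IsPartition {m k : ℕ} (S : Fin k → Finset (Fin m)) : Prop :=
  (∀ a b : Fin k, a ≠ b → Disjoint (S a) (S b)) ∧ Finset.univ.biUnion S = Finset.univ

/-- The rank one matrix `v v*`. -/
noncomputable def outer {d : ℕ} (v : EuclideanSpace ℂ (Fin d)) : Matrix (Fin d) (Fin d) ℂ :=
  Matrix.of fun a b => v a * star (v b)

/-- The operator norm of a complex matrix acting on Euclidean space. -/
noncomputable def opNorm {d : ℕ} (A : Matrix (Fin d) (Fin d) ℂ) : ℝ :=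
  ‖Matrix.toEuclideanCLM (n := Fin d) (𝕜 := ℂ) A‖

end HyperbolicMSS

/-!
The proof follows the method of interlacing polynomials. Put `p(z) = h(∑ᵢ zᵢ uᵢ)`, or
`p(z) = det (∑ᵢ zᵢ vᵢ vᵢ*)` in the case of matrices. This is a homogeneous stable polynomial
(`isStable_pencil`, by Gårding's theorem `aeval_ne_zero_of_mem_cone`, and
`det_sum_smul_outer_ne_zero`), and since the `uᵢ` have rank at most one, the restriction of `p` to
the line `1 + s eᵢ` is `p(1) (1 + s τᵢ)` with `τᵢ = tr uᵢ ≤ ε`. As iterated derivatives of `p` in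
positive directions are nonnegative on the positive orthant, this forces `∂ᵢ² p = 0`. The theorem
says that the coordinates can be coloured with `k` colours `j` so that the zeros of
`r ↦ p(r 1 - 1_{Sⱼ})` are at most `δ(kε, m) / k` (`exists_colouring_root_le`).

Every colouring `c` gives the polynomial `∏ⱼ p(x - k 1_{Sⱼ})`. Because `∂ᵢ² p = 0`, the average of
these polynomials over all colourings is `∏ᵢ (1 - ∂ᵢ) p(x)ᵏ`. If this average is positive for all
`x` with coordinates above `ρ`, then the coordinates can be coloured one after the other in such a
way that the partial averages stay positive above `ρ` (`exists_colour`, `exists_colouring`): the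
difference between a candidate and the current polynomial `G` is `-k Bⱼ`, and `Bⱼ / G` is
nonincreasing in positive directions, by stability.

It remains to see that `∏ᵢ (1 - ∂ᵢ) g` with `g = pᵏ` is positive above `ρ = δ(kε, m)`. The
polynomial `∏ⱼ (1 - yⱼ ∂ⱼ) g(x)` is hyperbolic in `(x, y)` jointly with respect to `(1, 0)`, so its
hyperbolicity cone is convex (`inCone_sum`). With `α = kε`, the cone contains `(c α 1, c eᵢ)` for
all `i` and `c ≥ 0` (`inCone_const_update`). By the barrier lemma `InCone.barrier`, for
`c = δ / (δ - 1)` a coordinate `j` with `yⱼ = 0` can be replaced by one with `yⱼ = 1` at the cost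
of a shift of `xⱼ` by `δ`. Processing all coordinates but `i` and then averaging over `i`
(`inCone_average`) shows that `(ρ 1, 1)` is in the cone, with
`ρ = (m c α + (m - 1) δ) / (m - 1 + c)`. The optimal choice of `δ` is the square root
`1 - 1/m + √(α - (1/m)(1 - 1/m))` of `δ(α, m)`, and then `ρ = δ²`. Averaging over the last
coordinate, rather than just processing it, accounts for the improvement over the bound of Marcus,
Spielman and Srivastava.
-/

namespace HyperbolicMSS

open Polynomial Filter Topology

/-! ### Restrictions of polynomials to lines -/

/-- The restriction `s ↦ f(x + s v)` of `f` to a line, as a univariate polynomial over an algebra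
containing the coordinates of `x` and `v`. -/
noncomputable def lineP {σ R A : Type*} [CommRing R] [CommRing A] [Algebra R A]
    (f : MvPolynomial σ R) (x v : σ → A) : A[X] :=
  MvPolynomial.aeval (fun i => C (x i) + C (v i) * X) f

section Line

variable {σ R A : Type*} [CommRing R] [CommRing A] [Algebra R A]

theorem eval_lineP (f : MvPolynomial σ R) (x v : σ → A) (s : A) :
    (lineP f x v).eval s = MvPolynomial.aeval (fun i => x i + s * v i) f := by
  unfold lineP
  induction f using MvPolynomial.induction_on with
  | C a => simp [Polynomial.algebraMap_apply]
  | add p q hp hq => simp [hp, hq]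
  | mul_X p i hp =>
    simp only [map_mul, eval_mul, hp, MvPolynomial.aeval_X, eval_add, eval_C, eval_X]
    ring

theorem derivative_lineP [Fintype σ] (f : MvPolynomial σ R) (x v : σ → A) :
    derivative (lineP f x v) = ∑ i, C (v i) * lineP (MvPolynomial.pderiv i f) x v := by
  classical
  unfold lineP
  induction f using MvPolynomial.induction_on with
  | C a => simp [Polynomial.algebraMap_apply]
  | add p q hp hq => simp [hp, hq, mul_add, Finset.sum_add_distrib]
  | mul_X p i hp =>
    simp only [map_mul, MvPolynomial.aeval_X, derivative_mul, hp, Derivation.leibniz,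
      MvPolynomial.pderiv_X, smul_eq_mul, map_add, mul_add, Finset.sum_add_distrib]
    have h1 : ∑ j, C (v j) * (MvPolynomial.aeval (fun i => C (x i) + C (v i) * X) p *
        MvPolynomial.aeval (fun i => C (x i) + C (v i) * X) 
          ((Pi.single j 1 : σ → MvPolynomial σ R) i))
        = MvPolynomial.aeval (fun i => C (x i) + C (v i) * X) p * C (v i) := by
      rw [Finset.sum_eq_single i]
      · rw [Pi.single_eq_same, map_one, mul_one, mul_comm]
      · intro j _ hj
        rw [Pi.single_eq_of_ne hj.symm, map_zero, mul_zero, mul_zero]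
      · simp
    have h2 : ∀ F : σ → A[X], ∑ j, C (v j) * ((C (x i) + C (v i) * X) * F j) =
        (C (x i) + C (v i) * X) * ∑ j, C (v j) * F j := fun F => by
      rw [Finset.mul_sum]
      exact Finset.sum_congr rfl fun _ _ => by ring
    rw [h1, h2]
    simp only [derivative_C, derivative_X]
    ring

theorem lineP_monomial_bound (x v : σ → A) (m : σ →₀ ℕ) (a : R) :
    (lineP (MvPolynomial.monomial m a) x v).natDegree ≤ m.degree ∧
      (lineP (MvPolynomial.monomial m a) x v).coeff m.degree =
        MvPolynomial.aeval v (MvPolynomial.monomial m a) := by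
  unfold lineP
  have h1 : ∀ i, (C (x i) + C (v i) * X).natDegree ≤ 1 := fun i =>
    natDegree_add_le_of_degree_le (by simp) ((natDegree_mul_le).trans (by simp [natDegree_X_le]))
  have hc : ∀ i, (C (x i) + C (v i) * X).coeff 1 = v i := fun i => by simp [coeff_C]
  induction m using Finsupp.induction_linear generalizing a with
  | zero => simp [Polynomial.algebraMap_apply]
  | add f g hf hg =>
    have : MvPolynomial.monomial (f + g) a = MvPolynomial.monomial f a *
        MvPolynomial.monomial g (1 : R) := by simp [MvPolynomial.monomial_mul]
    simp only [this, map_mul]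
    refine ⟨natDegree_mul_le.trans (by rw [map_add]; exact add_le_add (hf a).1 (hg 1).1), ?_⟩
    rw [map_add, coeff_mul_add_eq_of_natDegree_le (hf a).1 (hg 1).1, (hf a).2, (hg 1).2]
  | single i n =>
    have h2 : ((C (x i) + C (v i) * X) ^ n).natDegree ≤ n := by
      simpa using natDegree_pow_le_of_le n (h1 i)
    have h3 : ((C (x i) + C (v i) * X) ^ n).coeff n = v i ^ n := by
      simpa [hc] using coeff_pow_of_natDegree_le (h1 i) (m := n)
    rw [MvPolynomial.aeval_monomial, MvPolynomial.aeval_monomial]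
    simp only [Polynomial.algebraMap_apply, pow_zero, Finsupp.prod_single_index,
      Finsupp.degree_single]
    refine ⟨natDegree_C_mul_le _ _ |>.trans h2, ?_⟩
    rw [coeff_C_mul, h3]

/-- For homogeneous `f` the coefficient of `s ^ d` in `f(x + s v)` is `f(v)`. -/
theorem lineP_bound {f : MvPolynomial σ R} {d : ℕ} (hf : f.IsHomogeneous d) (x v : σ → A) :
    (lineP f x v).natDegree ≤ d ∧ (lineP f x v).coeff d = MvPolynomial.aeval v f := by
  have key : ∀ m ∈ f.support, m.degree = d := fun m hm => by
    rw [Finsupp.degree_eq_weight_one]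
    exact hf (MvPolynomial.mem_support_iff.1 hm)
  have hs : lineP f x v = ∑ m ∈ f.support, lineP (MvPolynomial.monomial m (f.coeff m)) x v := by
    unfold lineP
    conv_lhs => rw [f.as_sum, map_sum]
  constructor
  · rw [hs]
    refine natDegree_sum_le_of_forall_le _ _ fun m hm => ?_
    rw [← key m hm]; exact (lineP_monomial_bound x v m _).1
  · rw [hs, finsetSum_coeff]
    conv_rhs => rw [f.as_sum, map_sum]
    refine Finset.sum_congr rfl fun m hm => ?_
    rw [← key m hm]; exact (lineP_monomial_bound x v m _).2

theorem aeval_smul_of_isHomogeneous {f : MvPolynomial σ R} {d : ℕ} (hf : f.IsHomogeneous d)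
    (c : A) (x : σ → A) :
    MvPolynomial.aeval (fun i => c * x i) f = c ^ d * MvPolynomial.aeval x f := by
  rw [MvPolynomial.aeval_def, MvPolynomial.aeval_def, MvPolynomial.eval₂_eq, MvPolynomial.eval₂_eq,
    Finset.mul_sum]
  refine Finset.sum_congr rfl fun m hm => ?_
  have : m.degree = d := by
    rw [Finsupp.degree_eq_weight_one]
    exact hf (MvPolynomial.mem_support_iff.1 hm)
  rw [← this, Finsupp.degree_apply, ← Finset.prod_pow_eq_pow_sum]
  simp only [mul_pow, Finset.prod_mul_distrib]
  ring

end Line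

theorem aeval_ofReal {σ : Type*} (f : MvPolynomial σ ℝ) (x : σ → ℝ) :
    MvPolynomial.aeval (fun i => (x i : ℂ)) f = (MvPolynomial.eval x f : ℂ) := by
  have := MvPolynomial.aeval_algebraMap_apply (A := ℝ) (B := ℂ) x f
  simpa [Function.comp_def] using this

theorem aeval_lineP {σ : Type*} (f : MvPolynomial σ ℝ) (x v : σ → ℝ) (z : ℂ) :
    aeval z (lineP f x v) = MvPolynomial.aeval (fun i => (x i : ℂ) + z * v i) f := by
  unfold lineP
  induction f using MvPolynomial.induction_on with
  | C a => simp
  | add p q hp hq => rw [map_add, map_add, hp, hq, map_add]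
  | mul_X p i hp =>
    simp only [map_mul, hp, MvPolynomial.aeval_X, map_add, aeval_C, aeval_X,
      Complex.coe_algebraMap]
    ring

theorem continuous_aeval {σ : Type*} (f : MvPolynomial σ ℝ) :
    Continuous fun x : σ → ℂ => MvPolynomial.aeval x f := by
  induction f using MvPolynomial.induction_on with
  | C a => simpa using continuous_const
  | add p q hp hq =>
    simp only [map_add]
    exact hp.add hq
  | mul_X p i hp =>
    simp only [map_mul, MvPolynomial.aeval_X]
    exact hp.mul (continuous_apply i)

theorem aeval_conj {σ : Type*} (f : MvPolynomial σ ℝ) (z : σ → ℂ) :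
    MvPolynomial.aeval (fun i => (starRingEnd ℂ) (z i)) f =
      (starRingEnd ℂ) (MvPolynomial.aeval z f) := by
  induction f using MvPolynomial.induction_on with
  | C a => simp
  | add p q hp hq => simp [hp, hq]
  | mul_X p i hp => simp [hp]

/-! ### Zeros of univariate polynomials -/

/-- The logarithmic derivative of a polynomial without zeros in the closed upper half-plane maps
the real point `0` into the closed lower half-plane, and to a nonreal number unless it vanishes. -/
theorem im_logDeriv {q : ℂ[X]} (hq : ∀ s : ℂ, 0 ≤ s.im → q.eval s ≠ 0) :
    (q.derivative.eval 0 / q.eval 0).im < 0 ∨ q.derivative.eval 0 = 0 := by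
  have h0 : q.eval 0 ≠ 0 := hq 0 (by simp)
  have hs := (IsAlgClosed.splits q).eval_derivative_div_eval_of_ne_zero h0
  have hroot : ∀ r ∈ q.roots, (1 / (0 - r)).im < 0 := by
    intro r hr
    have hr0 : q.eval r = 0 := (mem_roots'.1 hr).2
    have him : r.im < 0 := by
      by_contra h
      exact hq r (not_lt.1 h) hr0
    have hn : 0 < Complex.normSq r := Complex.normSq_pos.2 (fun h => by simp [h] at him)
    simp only [zero_sub, one_div, Complex.inv_im, Complex.neg_im, Complex.normSq_neg, neg_neg]
    exact div_neg_of_neg_of_pos him hn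
  rcases Multiset.empty_or_exists_mem q.roots with he | ⟨r, hr⟩
  · right
    rw [he] at hs
    simp only [Multiset.map_zero, Multiset.sum_zero, div_eq_zero_iff, h0, or_false] at hs
    exact hs
  · left
    rw [hs]
    have : ∀ m : Multiset ℂ, (∀ r ∈ m, (1 / (0 - r)).im < 0) →
        ((m.map fun r => 1 / (0 - r)).sum).im ≤ 0 := by
      intro m
      induction m using Multiset.induction_on with
      | empty => simp
      | cons a s ih =>
        intro h
        rw [Multiset.map_cons, Multiset.sum_cons, Complex.add_im]
        have h1 := h a (by simp)
        have h2 := ih fun r hr => h r (by simp [hr])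
        linarith
    obtain ⟨m, hm⟩ := Multiset.exists_cons_of_mem hr
    rw [hm] at hroot ⊢
    rw [Multiset.map_cons, Multiset.sum_cons, Complex.add_im]
    have h1 := hroot r (by simp)
    have h2 := this m fun r hr => hroot r (by simp [hr])
    linarith

/-- If `q` has a small value at `s₀`, then it has a zero close to `s₀`. -/
theorem exists_root_near {q : ℂ[X]} {d : ℕ} (hd : q.natDegree ≤ d) {c : ℂ} (hc : q.coeff d = c)
    {s₀ : ℂ} {ε : ℝ} (hε : 0 < ε) (h : ‖q.eval s₀‖ < ‖c‖ * ε ^ d) :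
    ∃ r, q.eval r = 0 ∧ ‖s₀ - r‖ < ε := by
  by_contra! hcon
  have hc0 : c ≠ 0 := by
    rintro rfl
    simp only [norm_zero, zero_mul] at h
    exact absurd h (not_lt.2 (norm_nonneg _))
  have hdeg : q.natDegree = d := natDegree_eq_of_le_of_coeff_ne_zero hd (hc ▸ hc0)
  have hlead : q.leadingCoeff = c := by rw [leadingCoeff, hdeg, hc]
  have hcard : q.roots.card = d := by
    rw [← hdeg]; exact (IsAlgClosed.splits q).natDegree_eq_card_roots.symm
  have hev : q.eval s₀ = c * (q.roots.map fun r => s₀ - r).prod := by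
    conv_lhs => rw [(IsAlgClosed.splits q).eq_prod_roots]
    rw [eval_mul, eval_C, hlead, eval_multiset_prod, Multiset.map_map]
    simp
  have : ∀ m : Multiset ℂ, (∀ r ∈ m, ε ≤ ‖s₀ - r‖) →
      ε ^ m.card ≤ ‖(m.map fun r => s₀ - r).prod‖ := by
    intro m
    induction m using Multiset.induction_on with
    | empty => simp
    | cons a s ih =>
      intro h
      rw [Multiset.map_cons, Multiset.prod_cons, Multiset.card_cons, norm_mul, pow_succ']
      exact mul_le_mul (h a (by simp)) (ih fun r hr => h r (by simp [hr])) (by positivity)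
        (norm_nonneg _)
  have h2 := this q.roots fun r hr => hcon r (mem_roots'.1 hr).2
  rw [hcard] at h2
  rw [hev, norm_mul] at h
  exact absurd h (not_lt.2 (mul_le_mul_of_nonneg_left h2 (norm_nonneg _)))

/-! ### Gårding's theorem -/

/-- Zeros cannot cross the real axis: deform `h(s u + t e)` into `h(w + s u + t e)` along
`τ ↦ h(τ² w + s u + t e)`, where the square keeps the coefficient of `w` nonnegative for all
real `τ`. The set of parameters `τ` for which this polynomial in `s` has a zero in the closed upper
half-plane is open and closed in `ℝ`. -/
theorem aeval_ne_zero_of_homotopy {σ : Type*} {h : MvPolynomial σ ℝ} {d : ℕ}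
    (hd : h.IsHomogeneous d) (w : σ → ℂ) (t : ℂ) (e u : σ → ℝ)
    (hreal : ∀ τ s : ℝ, MvPolynomial.aeval
      (fun l => ((τ : ℂ) ^ 2 * w l + t * e l) + (s : ℂ) * u l) h ≠ 0)
    (h0 : ∀ s : ℂ, 0 ≤ s.im → MvPolynomial.aeval (fun l => t * e l + s * u l) h ≠ 0)
    (hlead : MvPolynomial.eval u h ≠ 0) (s : ℂ) (hs : 0 ≤ s.im) :
    MvPolynomial.aeval (fun l => (w l + t * e l) + s * u l) h ≠ 0 := by
  set A : Set ℝ := {τ | ∃ s : ℂ, 0 ≤ s.im ∧ MvPolynomial.aeval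
      (fun l => ((τ : ℂ) ^ 2 * w l + t * e l) + s * u l) h = 0} with hA
  have hleadC : MvPolynomial.aeval (fun l => (u l : ℂ)) h ≠ 0 := by
    rw [aeval_ofReal]; exact_mod_cast hlead
  have hcont : Continuous fun q : ℝ × (ℂ × ℂ) => MvPolynomial.aeval
      (fun l => q.2.2 * ((q.1 : ℂ) ^ 2 * w l + t * e l) + q.2.1 * (u l : ℂ)) h :=
    (continuous_aeval h).comp (by fun_prop)
  -- Homogeneous coordinates `s = a / b` make the set of candidate zeros compact.
  have hclosed : IsClosed A := by
    let Z : Set (ℝ × Metric.sphere (0 : ℂ × ℂ) 1) := {q | MvPolynomial.aeval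
      (fun l => q.2.1.2 * ((q.1 : ℂ) ^ 2 * w l + t * e l) + q.2.1.1 * (u l : ℂ)) h = 0 ∧
        0 ≤ (q.2.1.1 * (starRingEnd ℂ) q.2.1.2).im}
    have hZ : IsClosed Z := by
      refine IsClosed.inter (isClosed_eq (hcont.comp (f := fun q : ℝ × Metric.sphere (0 : ℂ × ℂ) 1
        => (q.1, (q.2 : ℂ × ℂ))) (by fun_prop)) continuous_const)
        (isClosed_le continuous_const (Complex.continuous_im.comp ?_))
      exact (by fun_prop : Continuous fun q : ℝ × Metric.sphere (0 : ℂ × ℂ) 1 => q.2.1.1).mul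
        (Complex.continuous_conj.comp (by fun_prop))
    have hAZ : A = Prod.fst '' Z := by
      ext τ
      constructor
      · rintro ⟨s, hs, hz⟩
        have hN : 0 < ‖((s, 1) : ℂ × ℂ)‖ := norm_pos_iff.2 (by simp)
        set N := ‖((s, 1) : ℂ × ℂ)‖
        refine ⟨(τ, ⟨((N : ℂ)⁻¹ * s, (N : ℂ)⁻¹), ?_⟩), ⟨?_, ?_⟩, rfl⟩
        · have : (((N : ℂ)⁻¹ * s, (N : ℂ)⁻¹) : ℂ × ℂ) = (N⁻¹ : ℝ) • ((s, 1) : ℂ × ℂ) := by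
            ext1 <;> simp
          rw [mem_sphere_zero_iff_norm, this, norm_smul, norm_inv, Real.norm_of_nonneg hN.le]
          exact inv_mul_cancel₀ hN.ne'
        · have := aeval_smul_of_isHomogeneous hd ((N : ℂ)⁻¹)
            (fun l => ((τ : ℂ) ^ 2 * w l + t * e l) + s * u l)
          rw [hz, mul_zero] at this
          simpa only [mul_add, mul_assoc] using this
        · simp only [map_inv₀, Complex.conj_ofReal]
          have : (N : ℂ)⁻¹ * s * (N : ℂ)⁻¹ = ((N⁻¹ * N⁻¹ : ℝ) : ℂ) * s := by push_cast; ring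
          rw [this, Complex.im_ofReal_mul]
          positivity
      · rintro ⟨⟨τ', ⟨⟨a, b⟩, hab⟩⟩, ⟨hz, him⟩, rfl⟩
        simp only at hz him ⊢
        have hb : b ≠ 0 := by
          rintro rfl
          simp only [zero_mul, zero_add] at hz
          rw [aeval_smul_of_isHomogeneous hd, mul_eq_zero, or_iff_left hleadC] at hz
          have ha := eq_zero_of_pow_eq_zero hz
          simp [ha] at hab
        refine ⟨a / b, ?_, ?_⟩
        · have : a / b = ((Complex.normSq b)⁻¹ : ℝ) * (a * (starRingEnd ℂ) b) := by
            rw [div_eq_mul_inv, Complex.inv_def]; push_cast; ring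
          rw [this, Complex.im_ofReal_mul]
          exact mul_nonneg (inv_nonneg.2 (Complex.normSq_nonneg _)) him
        · have := aeval_smul_of_isHomogeneous hd b
            (fun l => ((τ' : ℂ) ^ 2 * w l + t * e l) + a / b * u l)
          have h2 : (fun l => b * (((τ' : ℂ) ^ 2 * w l + t * e l) + a / b * u l)) =
              fun l => b * ((τ' : ℂ) ^ 2 * w l + t * e l) + a * (u l : ℂ) := by
            ext l; field_simp
          rw [h2, hz] at this
          exact (mul_eq_zero.1 this.symm).resolve_left (pow_ne_zero _ hb)
    rw [hAZ]
    exact isClosedMap_fst_of_compactSpace Z hZ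
  have hopen : IsOpen A := by
    rw [isOpen_iff_mem_nhds]
    rintro τ₀ ⟨s₀, hs₀, hz⟩
    have him : 0 < s₀.im := by
      rcases hs₀.lt_or_eq with h1 | h1
      · exact h1
      · exfalso
        apply hreal τ₀ s₀.re
        have : ((s₀.re : ℝ) : ℂ) = s₀ := Complex.ext rfl (by simpa using h1)
        rw [this]; exact hz
    have hc : Continuous fun τ : ℝ => ‖MvPolynomial.aeval
        (fun l => ((τ : ℂ) ^ 2 * w l + t * e l) + s₀ * u l) h‖ :=
      ((continuous_aeval h).comp (by fun_prop)).norm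
    have hpos : 0 < ‖MvPolynomial.aeval (fun l => (u l : ℂ)) h‖ * s₀.im ^ d :=
      mul_pos (norm_pos_iff.2 hleadC) (pow_pos him _)
    have hev : ∀ᶠ τ : ℝ in 𝓝 τ₀, ‖MvPolynomial.aeval
        (fun l => ((τ : ℂ) ^ 2 * w l + t * e l) + s₀ * u l) h‖ <
          ‖MvPolynomial.aeval (fun l => (u l : ℂ)) h‖ * s₀.im ^ d := by
      apply hc.continuousAt.eventually_lt continuousAt_const
      rw [hz, norm_zero]; exact hpos
    filter_upwards [hev] with τ hτ
    have hb := lineP_bound hd (fun l => (τ : ℂ) ^ 2 * w l + t * e l) (fun l => (u l : ℂ))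
    rw [← eval_lineP h (fun l => (τ : ℂ) ^ 2 * w l + t * e l) (fun l => (u l : ℂ))] at hτ
    obtain ⟨r, hr, hrs⟩ := exists_root_near hb.1 hb.2 him hτ
    rw [eval_lineP] at hr
    refine ⟨r, ?_, hr⟩
    have := (Complex.abs_im_le_norm (s₀ - r)).trans_lt hrs
    rw [Complex.sub_im, abs_lt] at this
    linarith [this.2]
  have h0A : (0 : ℝ) ∉ A := by
    rintro ⟨s, hs, hz⟩
    exact h0 s hs (by simpa using hz)
  have hAe : A = ∅ := (isClopen_iff.1 ⟨hclosed, hopen⟩).resolve_right fun hu => h0A (hu ▸ trivial)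
  intro hz
  have : (1 : ℝ) ∈ A := ⟨s, hs, by simpa using hz⟩
  rw [hAe] at this
  exact this

/-- Gårding's theorem: if `h` is hyperbolic with respect to `e`, then it does not vanish at
`x + ∑ sᵢ uᵢ + t e` for vectors `uᵢ` of the closed hyperbolicity cone when the imaginary parts
of the `sᵢ` are nonnegative and that of `t` is positive. -/
theorem aeval_ne_zero_of_mem_cone {σ ι : Type*} {h : MvPolynomial σ ℝ} {d : ℕ}
    (hd : h.IsHomogeneous d) (e : σ → ℝ)
    (hyp : ∀ (x : σ → ℝ) (z : ℂ), 0 < z.im →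
      MvPolynomial.aeval (fun l => (x l : ℂ) + z * e l) h ≠ 0)
    (u : ι → σ → ℝ)
    (hu : ∀ i, ∀ t : ℝ, 0 < t → MvPolynomial.eval (fun l => t * e l + u i l) h ≠ 0)
    (S : Finset ι) (x : σ → ℝ) (s : ι → ℂ) (t : ℂ) (hs : ∀ i ∈ S, 0 ≤ (s i).im)
    (ht : 0 < t.im) :
    MvPolynomial.aeval (fun l => (x l : ℂ) + ∑ i ∈ S, s i * u i l + t * e l) h ≠ 0 := by
  classical
  induction S using Finset.induction_on generalizing x s t with
  | empty => simpa using hyp x t ht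
  | insert i S hi ih =>
    have hsi : 0 ≤ (s i).im := hs i (by simp)
    -- Move `uᵢ` into the open cone, at the expense of part of `t`.
    obtain ⟨η, hη, hη'⟩ : ∃ η : ℝ, 0 < η ∧ 0 < (t - η * s i).im := by
      refine ⟨t.im / (2 * ((s i).im + 1)), by positivity, ?_⟩
      rw [Complex.sub_im, Complex.im_ofReal_mul, sub_pos, div_mul_eq_mul_div,
        div_lt_iff₀ (by positivity)]
      nlinarith
    have key := aeval_ne_zero_of_homotopy hd (fun l => (x l : ℂ) + ∑ j ∈ S, s j * u j l)
      (t - η * s i) e (fun l => η * e l + u i l) ?_ ?_ (hu i η hη) (s i) hsi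
    · convert key using 3
      ext l
      rw [Finset.sum_insert hi]
      push_cast
      ring
    · intro τ r
      have := ih (fun l => τ ^ 2 * x l + r * u i l) (fun j => (τ : ℂ) ^ 2 * s j)
        (t - η * s i + r * η) ?_ ?_
      · convert this using 3
        ext l
        simp only [Finset.mul_sum, mul_add, mul_assoc]
        push_cast
        ring
      · intro j hj
        have : ((τ : ℂ) ^ 2 * s j) = ((τ ^ 2 : ℝ) : ℂ) * s j := by push_cast; ring
        rw [this, Complex.im_ofReal_mul]
        exact mul_nonneg (sq_nonneg _) (hs j (by simp [hj]))
      · have : ((r : ℂ) * (η : ℂ)).im = 0 := by simp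
        rw [Complex.add_im, this, add_zero]
        exact hη'
    · intro r hr hz
      set t' := t - η * s i
      have ht' : t' ≠ 0 := fun h => by simp [h] at hη'
      -- The zero `r` has the form `-t' / κ` with `κ > 0`, so it is in the lower half-plane.
      have hr0 : r ≠ 0 := by
        rintro rfl
        have := hyp 0 t' hη'
        apply this
        simpa using hz
      have hz2 : MvPolynomial.aeval (fun l => ((u i l : ℝ) : ℂ) + (t' / r + η) * e l) h = 0 := by
        have h1 := aeval_smul_of_isHomogeneous hd r
          (fun l => ((u i l : ℝ) : ℂ) + (t' / r + η) * e l)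
        have h2 : (fun l => r * (((u i l : ℝ) : ℂ) + (t' / r + η) * e l)) =
            fun l => t' * (e l : ℂ) + r * ((η * e l + u i l : ℝ) : ℂ) := by
          ext l; push_cast; field_simp; ring
        rw [h2, hz] at h1
        exact (mul_eq_zero.1 h1.symm).resolve_left (pow_ne_zero _ hr0)
      set κ := t' / r with hκ
      have him : κ.im = 0 := by
        by_contra hne
        rcases lt_or_gt_of_ne hne with hlt | hgt
        · apply hyp (u i) ((starRingEnd ℂ) (κ + η)) (by simpa using hlt)
          have := aeval_conj h (fun l => ((u i l : ℝ) : ℂ) + (κ + η) * e l)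
          rw [hz2, map_zero] at this
          simpa using this
        · exact hyp (u i) (κ + η) (by simpa using hgt) hz2
      have hκr : (κ.re : ℂ) = κ := Complex.ext rfl (by simp [him])
      have hle : κ.re + η ≤ 0 := by
        by_contra hlt
        apply hu i (κ.re + η) (not_le.1 hlt)
        have h3 := aeval_ofReal h (fun l => (κ.re + η) * e l + u i l)
        have h4 : (fun l => (((κ.re + η) * e l + u i l : ℝ) : ℂ)) =
            fun l => ((u i l : ℝ) : ℂ) + (κ + η) * e l := by
          ext l; push_cast; rw [hκr]; ring
        rw [h4, hz2] at h3
        exact_mod_cast h3.symm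
      have hrt : t' = (κ.re : ℂ) * r := by rw [hκr, hκ]; field_simp
      have : t'.im = κ.re * r.im := by rw [hrt, Complex.im_ofReal_mul]
      nlinarith

/-! ### Derivatives of stable polynomials -/

/-- The derivative of `f` in the direction `v`. -/
noncomputable def dirDeriv {ι : Type*} [Fintype ι] (v : ι → ℝ) (f : MvPolynomial ι ℝ) :
    MvPolynomial ι ℝ :=
  ∑ i, MvPolynomial.C (v i) * MvPolynomial.pderiv i f

/-- A real polynomial is stable if it has no zeros with all coordinates in the open upper
half-plane. -/
def IsStable {ι : Type*} (f : MvPolynomial ι ℝ) : Prop :=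
  ∀ z : ι → ℂ, (∀ i, 0 < (z i).im) → MvPolynomial.aeval z f ≠ 0

/-- Homogeneous polynomials of degree `d` that have no zeros with all coordinates in the open right
half-plane and are positive on the open positive orthant. -/
structure IsPosHurwitz {ι : Type*} (d : ℕ) (f : MvPolynomial ι ℝ) : Prop where
  homogeneous : f.IsHomogeneous d
  ne_zero : ∀ z : ι → ℂ, (∀ i, 0 < (z i).re) → MvPolynomial.aeval z f ≠ 0
  pos : ∀ x : ι → ℝ, (∀ i, 0 < x i) → 0 < MvPolynomial.eval x f

/-- All `l`-fold derivatives of `f` in strictly positive directions are nonnegative on the open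
positive orthant. -/
def IteratedNonneg {ι : Type*} [Fintype ι] : ℕ → MvPolynomial ι ℝ → Prop
  | 0, f => ∀ x : ι → ℝ, (∀ i, 0 < x i) → 0 ≤ MvPolynomial.eval x f
  | l + 1, f => ∀ v : ι → ℝ, (∀ i, 0 < v i) → IteratedNonneg l (dirDeriv v f)

theorem pos_of_ne_zero_on_Icc {g : ℝ → ℝ} (hg : Continuous g)
    (h0 : ∀ s ∈ Set.Icc (0 : ℝ) 1, g s ≠ 0) (hpos : 0 < g 0) : 0 < g 1 := by
  by_contra hle
  obtain ⟨s, hs, hgs⟩ := intermediate_value_Icc' zero_le_one hg.continuousOn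
    (show (0 : ℝ) ∈ Set.Icc (g 1) (g 0) from ⟨not_lt.1 hle, hpos.le⟩)
  exact h0 s hs hgs

/-- Multiplication by `i` maps the right half-plane to the upper half-plane, and the positive
orthant is connected. -/
theorem isPosHurwitz_of_isStable {ι : Type*} {d : ℕ} {f : MvPolynomial ι ℝ}
    (hf : f.IsHomogeneous d) (hst : IsStable f) (h1 : 0 < MvPolynomial.eval (fun _ => 1) f) :
    IsPosHurwitz d f := by
  have hne : ∀ z : ι → ℂ, (∀ i, 0 < (z i).re) → MvPolynomial.aeval z f ≠ 0 := by
    intro z hz h0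
    apply hst (fun i => Complex.I * z i) (fun i => by simpa using hz i)
    rw [aeval_smul_of_isHomogeneous hf, h0, mul_zero]
  refine ⟨hf, hne, fun x hx => ?_⟩
  have key := pos_of_ne_zero_on_Icc
    (g := fun s => MvPolynomial.eval (fun i => 1 + s * (x i - 1)) f)
    ((MvPolynomial.continuous_eval f).comp (by fun_prop)) ?_ (by simpa using h1)
  · simpa using key
  · rintro s ⟨hs0, hs1⟩ h0
    apply hne (fun i => ((1 + s * (x i - 1) : ℝ) : ℂ))
    · intro i
      rw [Complex.ofReal_re]
      rcases hs1.eq_or_lt with rfl | hs1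
      · simpa using hx i
      · nlinarith [hx i]
    · rw [aeval_ofReal, h0, Complex.ofReal_zero]

/-- The logarithmic derivative of a nonconstant polynomial without zeros in the closed right
half-plane maps the real point `0` into the open right half-plane. -/
theorem re_logDeriv_pos {q : ℂ[X]} (hq : ∀ s : ℂ, 0 ≤ s.re → q.eval s ≠ 0)
    (hdeg : 0 < q.natDegree) : 0 < (q.derivative.eval 0 / q.eval 0).re := by
  have h0 : q.eval 0 ≠ 0 := hq 0 (by simp)
  have hs := (IsAlgClosed.splits q).eval_derivative_div_eval_of_ne_zero h0
  have hroot : ∀ r ∈ q.roots, 0 < (1 / (0 - r)).re := by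
    intro r hr
    have hr0 : q.eval r = 0 := (mem_roots'.1 hr).2
    have hre : r.re < 0 := by
      by_contra h
      exact hq r (not_lt.1 h) hr0
    have hn : 0 < Complex.normSq r := Complex.normSq_pos.2 (fun h => by simp [h] at hre)
    simp only [zero_sub, one_div, Complex.inv_re, Complex.neg_re, Complex.normSq_neg]
    exact div_pos (by linarith) hn
  have hne : q.roots ≠ 0 := by
    intro he
    have := (IsAlgClosed.splits q).natDegree_eq_card_roots
    rw [he, Multiset.card_zero] at this
    omega
  rw [hs]
  have : ∀ m : Multiset ℂ, (∀ r ∈ m, 0 < (1 / (0 - r)).re) →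
      0 ≤ ((m.map fun r => 1 / (0 - r)).sum).re := by
    intro m
    induction m using Multiset.induction_on with
    | empty => simp
    | cons a s ih =>
      intro h
      rw [Multiset.map_cons, Multiset.sum_cons, Complex.add_re]
      have h1 := h a (by simp)
      have h2 := ih fun r hr => h r (by simp [hr])
      linarith
  obtain ⟨r, hr⟩ := Multiset.exists_mem_of_ne_zero hne
  obtain ⟨m, hm⟩ := Multiset.exists_cons_of_mem hr
  rw [hm] at hroot ⊢
  rw [Multiset.map_cons, Multiset.sum_cons, Complex.add_re]
  have h1 := hroot r (by simp)
  have h2 := this m fun r hr => hroot r (by simp [hr])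
  linarith

section Derivatives

variable {ι : Type*} [Fintype ι]

theorem derivative_lineP_eval {A : Type*} [CommRing A] [Algebra ℝ A] (f : MvPolynomial ι ℝ)
    (x : ι → A) (v : ι → ℝ) (s : A) :
    (derivative (lineP f x (fun i => algebraMap ℝ A (v i)))).eval s =
      MvPolynomial.aeval (fun i => x i + s * algebraMap ℝ A (v i)) (dirDeriv v f) := by
  rw [derivative_lineP, eval_finsetSum, dirDeriv, map_sum]
  refine Finset.sum_congr rfl fun i _ => ?_
  rw [eval_mul, eval_C, eval_lineP, map_mul, MvPolynomial.algHom_C]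

theorem isPosHurwitz_dirDeriv {d : ℕ} {f : MvPolynomial ι ℝ} (hf : IsPosHurwitz (d + 1) f)
    {v : ι → ℝ} (hv : ∀ i, 0 < v i) : IsPosHurwitz d (dirDeriv v f) := by
  have key : ∀ z : ι → ℂ, (∀ i, 0 < (z i).re) →
      0 < (MvPolynomial.aeval z (dirDeriv v f) / MvPolynomial.aeval z f).re := by
    intro z hz
    have hb := lineP_bound hf.homogeneous z (fun i => algebraMap ℝ ℂ (v i))
    have h1 := re_logDeriv_pos (q := lineP f z (fun i => algebraMap ℝ ℂ (v i))) ?_ ?_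
    · rw [derivative_lineP_eval, eval_lineP] at h1
      simpa using h1
    · intro s hs
      rw [eval_lineP]
      apply hf.ne_zero
      intro i
      have h2 := hz i
      have h3 := mul_nonneg hs (hv i).le
      simp only [Complex.coe_algebraMap, Complex.add_re, Complex.mul_re, Complex.ofReal_re,
        Complex.ofReal_im, mul_zero, sub_zero]
      linarith
    · have : (lineP f z (fun i => algebraMap ℝ ℂ (v i))).coeff (d + 1) ≠ 0 := by
        rw [hb.2]
        apply hf.ne_zero
        simpa using hv
      have := le_natDegree_of_ne_zero this
      omega
  refine ⟨?_, fun z hz h0 => ?_, fun x hx => ?_⟩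
  · refine MvPolynomial.IsHomogeneous.sum _ _ _ fun i _ => ?_
    simpa using (MvPolynomial.isHomogeneous_C ι (v i)).mul (hf.homogeneous.pderiv (i := i))
  · have := key z hz
    rw [h0] at this
    simp at this
  · have h1 := key (fun i => (x i : ℂ)) (by simpa using hx)
    rw [aeval_ofReal, aeval_ofReal, ← Complex.ofReal_div, Complex.ofReal_re] at h1
    exact (div_pos_iff_of_pos_right (hf.pos x hx)).1 h1

theorem dirDeriv_add (v : ι → ℝ) (f g : MvPolynomial ι ℝ) :
    dirDeriv v (f + g) = dirDeriv v f + dirDeriv v g := by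
  simp [dirDeriv, mul_add, Finset.sum_add_distrib]

theorem dirDeriv_C_mul (v : ι → ℝ) (c : ℝ) (f : MvPolynomial ι ℝ) :
    dirDeriv v (MvPolynomial.C c * f) = MvPolynomial.C c * dirDeriv v f := by
  simp only [dirDeriv, Finset.mul_sum, MvPolynomial.pderiv_C_mul]
  exact Finset.sum_congr rfl fun _ _ => by ring

theorem iteratedNonneg_zero (l : ℕ) : IteratedNonneg l (0 : MvPolynomial ι ℝ) := by
  induction l with
  | zero => intro x _; simp
  | succ l ih => intro v _; simpa [dirDeriv] using ih

theorem iteratedNonneg_of_isPosHurwitz {d : ℕ} {f : MvPolynomial ι ℝ} (hf : IsPosHurwitz d f)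
    (l : ℕ) : IteratedNonneg l f := by
  induction l generalizing d f with
  | zero => exact fun x hx => (hf.pos x hx).le
  | succ l ih =>
    intro v hv
    cases d with
    | zero =>
      obtain ⟨a, rfl⟩ : ∃ a, f = MvPolynomial.C a :=
        ⟨_, MvPolynomial.totalDegree_eq_zero_iff_eq_C.1
          (Nat.le_zero.1 hf.homogeneous.totalDegree_le)⟩
      simpa [dirDeriv] using iteratedNonneg_zero l
    | succ d => exact ih (isPosHurwitz_dirDeriv hf hv)

theorem iteratedNonneg_of_perturbation {l : ℕ} {a b : MvPolynomial ι ℝ}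
    (h : ∀ η : ℝ, 0 < η → IteratedNonneg l (a + MvPolynomial.C η * b)) : IteratedNonneg l a := by
  induction l generalizing a b with
  | zero =>
    intro x hx
    have hlim : Tendsto (fun η : ℝ => MvPolynomial.eval x a + η * MvPolynomial.eval x b) (𝓝[>] 0)
        (𝓝 (MvPolynomial.eval x a + 0 * MvPolynomial.eval x b)) :=
      (Continuous.tendsto (by fun_prop) 0).mono_left nhdsWithin_le_nhds
    rw [zero_mul, add_zero] at hlim
    refine ge_of_tendsto hlim ?_
    filter_upwards [self_mem_nhdsWithin] with η hη
    simpa using h η hη x hx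
  | succ l ih =>
    intro v hv
    refine ih (b := dirDeriv v b) fun η hη => ?_
    rw [← dirDeriv_C_mul, ← dirDeriv_add]
    exact h η hη v hv

/-- The direction `eᵢ` is the limit of the strictly positive directions `eᵢ + η (1, …, 1)`. -/
theorem iteratedNonneg_pderiv {f : MvPolynomial ι ℝ} (hf : ∀ l, IteratedNonneg l f) (i : ι)
    (l : ℕ) : IteratedNonneg l (MvPolynomial.pderiv i f) := by
  classical
  refine iteratedNonneg_of_perturbation (b := dirDeriv (fun _ => 1) f) fun η hη => ?_
  have := hf (l + 1) (fun j => Pi.single (M := fun _ => ℝ) i 1 j + η) (fun j => by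
    by_cases hj : j = i
    · subst hj; simp; linarith
    · simpa [Pi.single_eq_of_ne hj] using hη)
  convert this using 1
  simp only [dirDeriv, map_add, add_mul, Finset.sum_add_distrib, Finset.mul_sum, map_one, one_mul]
  congr 1
  rw [Finset.sum_eq_single i]
  · simp
  · intro j _ hj
    simp [Pi.single_eq_of_ne hj]
  · simp

/-- A polynomial with nonnegative derivatives on the positive orthant is monotone there, so that it
vanishes on `(0, 1)^ι`, hence identically, once it vanishes at the all-ones vector. -/
theorem eq_zero_of_iteratedNonneg {f : MvPolynomial ι ℝ} (hf : ∀ l, IteratedNonneg l f)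
    (h1 : MvPolynomial.eval (fun _ => 1) f = 0) : f = 0 := by
  refine MvPolynomial.funext_set (fun _ => Set.Ioo (0 : ℝ) 1)
    (fun _ => Set.Ioo_infinite zero_lt_one) fun x hx => ?_
  rw [map_zero]
  have hx' : ∀ i, 0 < x i ∧ x i < 1 := fun i => hx i trivial
  refine le_antisymm ?_ (hf 0 x fun i => (hx' i).1)
  set q := lineP f x (fun i => algebraMap ℝ ℝ (1 - x i)) with hq
  have hmono : MonotoneOn (fun s => q.eval s) (Set.Icc 0 1) := by
    refine monotoneOn_of_deriv_nonneg (convex_Icc _ _) q.continuous.continuousOn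
      q.differentiable.differentiableOn fun s hs => ?_
    rw [interior_Icc] at hs
    rw [Polynomial.deriv, hq, derivative_lineP_eval]
    refine hf 1 (fun i => 1 - x i) (fun i => by linarith [(hx' i).2]) _ fun i => ?_
    have := mul_pos hs.1 (sub_pos.2 (hx' i).2)
    have := (hx' i).1
    simp only [Algebra.algebraMap_self, RingHom.id_apply]
    linarith
  have := hmono (Set.left_mem_Icc.2 zero_le_one) (Set.right_mem_Icc.2 zero_le_one) zero_le_one
  simp only [hq, eval_lineP] at this
  simp only [zero_mul, add_zero, one_mul, Algebra.algebraMap_self, RingHom.id_apply,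
    add_sub_cancel, MvPolynomial.aeval_eq_eval] at this
  rw [← h1]
  exact this

end Derivatives

/-! ### The polynomial `∏ⱼ (1 - yⱼ ∂ⱼ) f(x)` -/

section Mixed

variable {ι : Type*} [Fintype ι] {R : Type*} [CommRing R]

/-- The polynomial `(1 - yⱼ ∂ⱼ) xⱼⁿ`, where `xⱼ` and `yⱼ` are the variables `Sum.inl j` and
`Sum.inr j`. -/
noncomputable def mixedFactor (j : ι) (n : ℕ) : MvPolynomial (ι ⊕ ι) R :=
  MvPolynomial.X (Sum.inl j) ^ n -
    MvPolynomial.C (n : R) * MvPolynomial.X (Sum.inr j) * MvPolynomial.X (Sum.inl j) ^ (n - 1)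

/-- The polynomial `∏ⱼ (1 - yⱼ ∂ⱼ) f(x)` in the variables `x` (left summand) and `y` (right
summand), defined on monomials by its product formula. -/
noncomputable def mixed : MvPolynomial ι R →ₗ[R] MvPolynomial (ι ⊕ ι) R :=
  (MvPolynomial.basisMonomials ι R).constr R fun m => ∏ j, mixedFactor j (m j)

theorem mixed_monomial (m : ι →₀ ℕ) (a : R) :
    mixed (MvPolynomial.monomial m a) = MvPolynomial.C a * ∏ j, mixedFactor j (m j) := by
  have h : MvPolynomial.monomial m a = a • MvPolynomial.basisMonomials ι R m := by
    simp [MvPolynomial.smul_monomial]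
  rw [h, map_smul, mixed, Module.Basis.constr_basis, MvPolynomial.smul_eq_C_mul]

theorem pderiv_mixed (f : MvPolynomial ι R) (i : ι) :
    MvPolynomial.pderiv (Sum.inl i) (mixed f) = mixed (MvPolynomial.pderiv i f) := by
  classical
  induction f using MvPolynomial.induction_on' with
  | add p q hp hq => simp [hp, hq]
  | monomial m a =>
    rw [MvPolynomial.pderiv_monomial, mixed_monomial, mixed_monomial, MvPolynomial.pderiv_C_mul,
      ← Finset.mul_prod_erase _ _ (Finset.mem_univ i),
      ← Finset.mul_prod_erase (a := i) _ _ (Finset.mem_univ i), MvPolynomial.pderiv_mul]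
    have h0 : ∀ S : Finset ι, i ∉ S → MvPolynomial.pderiv (Sum.inl i)
        (∏ j ∈ S, (mixedFactor j (m j) : MvPolynomial (ι ⊕ ι) R)) = 0 := by
      intro S
      induction S using Finset.induction_on with
      | empty => simp
      | insert j S hj ih =>
        intro hi
        rw [Finset.mem_insert, not_or] at hi
        have hj' : (Sum.inl j : ι ⊕ ι) ≠ Sum.inl i := fun h => hi.1 (Sum.inl.inj h).symm
        rw [Finset.prod_insert hj, MvPolynomial.pderiv_mul, ih hi.2]
        simp [mixedFactor, MvPolynomial.pderiv_X_of_ne hj']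
    have h1 : MvPolynomial.pderiv (Sum.inl i) (mixedFactor i (m i) : MvPolynomial (ι ⊕ ι) R) =
        MvPolynomial.C (m i : R) * mixedFactor i (m i - 1) := by
      rcases m i with _ | _ | n <;>
        simp [mixedFactor]
      ring
    have h2 : ∏ j ∈ Finset.univ.erase i, (mixedFactor j (m j) : MvPolynomial (ι ⊕ ι) R) =
        ∏ j ∈ Finset.univ.erase i, mixedFactor j ((m - Finsupp.single i 1 : ι →₀ ℕ) j) := by
      refine Finset.prod_congr rfl fun j hj => ?_
      have : i ≠ j := (Finset.ne_of_mem_erase hj).symm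
      simp [Finsupp.single_eq_of_ne' this]
    rw [h0 _ (Finset.notMem_erase i _), h1, h2]
    simp only [Finsupp.tsub_apply, Finsupp.single_eq_same, mul_zero, add_zero, map_mul]
    ring

theorem map_mixed {S : Type*} [CommRing S] (φ : R →+* S) (f : MvPolynomial ι R) :
    MvPolynomial.map φ (mixed f) = mixed (MvPolynomial.map φ f) := by
  induction f using MvPolynomial.induction_on' with
  | add p q hp hq => simp [hp, hq]
  | monomial m a =>
    rw [MvPolynomial.map_monomial, mixed_monomial, mixed_monomial]
    simp [mixedFactor, map_prod]

theorem isHomogeneous_mixed {f : MvPolynomial ι R} {d : ℕ} (hf : f.IsHomogeneous d) :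
    (mixed f).IsHomogeneous d := by
  rw [f.as_sum, map_sum]
  refine MvPolynomial.IsHomogeneous.sum _ _ _ fun m hm => ?_
  have hd : ∑ j, m j = d := by
    have := hf (MvPolynomial.mem_support_iff.1 hm)
    rw [← this, ← Finsupp.degree_eq_sum, Finsupp.degree_eq_weight_one]
    rfl
  rw [mixed_monomial, ← hd, ← zero_add (∑ j, m j)]
  refine (MvPolynomial.isHomogeneous_C _ _).mul
    (MvPolynomial.IsHomogeneous.prod _ _ _ fun j _ => ?_)
  refine (MvPolynomial.isHomogeneous_X_pow _ _).sub ?_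
  rcases m j with _ | n
  · simpa using MvPolynomial.isHomogeneous_zero _ _ _
  · have := ((MvPolynomial.isHomogeneous_C (ι ⊕ ι) ((n + 1 : ℕ) : R)).mul
      (MvPolynomial.isHomogeneous_X R (Sum.inr j))).mul
      (MvPolynomial.isHomogeneous_X_pow (R := R) (Sum.inl j : ι ⊕ ι) n)
    convert this using 1
    · simp
    · omega

variable {A : Type*} [CommRing A] [Algebra R A]

/-- The value at `(x, y)` of `∏ⱼ (1 - yⱼ ∂ⱼ) f(x)`. -/
noncomputable def mixedEval (f : MvPolynomial ι R) (x y : ι → A) : A :=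
  MvPolynomial.aeval (Sum.elim x y) (mixed f)

theorem mixedEval_monomial (m : ι →₀ ℕ) (a : R) (x y : ι → A) :
    mixedEval (MvPolynomial.monomial m a) x y =
      algebraMap R A a * ∏ j, (x j ^ m j - m j * y j * x j ^ (m j - 1)) := by
  simp [mixedEval, mixed_monomial, mixedFactor, map_prod, MvPolynomial.algHom_C]

theorem mixedEval_add (f g : MvPolynomial ι R) (x y : ι → A) :
    mixedEval (f + g) x y = mixedEval f x y + mixedEval g x y := by
  simp [mixedEval]

theorem mixedEval_sum {κ : Type*} (s : Finset κ) (f : κ → MvPolynomial ι R) (x y : ι → A) :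
    mixedEval (∑ j ∈ s, f j) x y = ∑ j ∈ s, mixedEval (f j) x y := by
  simp [mixedEval]

theorem mixedEval_C_mul (c : R) (f : MvPolynomial ι R) (x y : ι → A) :
    mixedEval (MvPolynomial.C c * f) x y = algebraMap R A c * mixedEval f x y := by
  rw [mixedEval, ← MvPolynomial.smul_eq_C_mul, map_smul, map_smul, Algebra.smul_def, mixedEval]

theorem mixedEval_zero_right (f : MvPolynomial ι R) (x : ι → A) :
    mixedEval f x 0 = MvPolynomial.aeval x f := by
  induction f using MvPolynomial.induction_on' with
  | add p q hp hq => rw [mixedEval_add, hp, hq, map_add]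
  | monomial m a =>
    rw [mixedEval_monomial, MvPolynomial.aeval_monomial, Finsupp.prod_fintype _ _ (by simp)]
    simp

/-- `∏ⱼ (1 - yⱼ ∂ⱼ) f` is affine in `yᵢ`. -/
theorem mixedEval_update [DecidableEq ι] (f : MvPolynomial ι R) (x y : ι → A) (i : ι) (c : A) :
    mixedEval f x (Function.update y i c) = mixedEval f x (Function.update y i 0) -
      c * mixedEval (MvPolynomial.pderiv i f) x (Function.update y i 0) := by
  induction f using MvPolynomial.induction_on' with
  | add p q hp hq => simp only [mixedEval_add, map_add, hp, hq]; ring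
  | monomial m a =>
    rw [MvPolynomial.pderiv_monomial]
    simp only [mixedEval_monomial]
    rw [← Finset.mul_prod_erase _ _ (Finset.mem_univ i),
      ← Finset.mul_prod_erase (a := i) _ _ (Finset.mem_univ i),
      ← Finset.mul_prod_erase (a := i) _ _ (Finset.mem_univ i)]
    have h1 : ∀ c : A, ∏ j ∈ Finset.univ.erase i, (x j ^ m j -
        m j * Function.update y i c j * x j ^ (m j - 1)) =
        ∏ j ∈ Finset.univ.erase i, (x j ^ m j - m j * y j * x j ^ (m j - 1)) := fun c =>
      Finset.prod_congr rfl fun j hj => by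
        rw [Function.update_of_ne (Finset.ne_of_mem_erase hj)]
    have h2 : ∏ j ∈ Finset.univ.erase i, (x j ^ (m - Finsupp.single i 1 : ι →₀ ℕ) j -
        ((m - Finsupp.single i 1 : ι →₀ ℕ) j : ℕ) * Function.update y i 0 j *
          x j ^ ((m - Finsupp.single i 1 : ι →₀ ℕ) j - 1)) =
        ∏ j ∈ Finset.univ.erase i, (x j ^ m j - m j * y j * x j ^ (m j - 1)) := by
      refine Finset.prod_congr rfl fun j hj => ?_
      have : i ≠ j := (Finset.ne_of_mem_erase hj).symm
      rw [Function.update_of_ne this.symm]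
      simp [Finsupp.single_eq_of_ne' this]
    rw [h1, h1, h2]
    simp only [Function.update_self, Finsupp.tsub_apply, Finsupp.single_eq_same, mul_zero,
      zero_mul, sub_zero, map_mul, map_natCast]
    ring

theorem eval_lineP_mixed (f : MvPolynomial ι R) (x y v : ι → A) (s : A) :
    (lineP (mixed f) (Sum.elim x y) (Sum.elim v 0)).eval s =
      mixedEval f (fun i => x i + s * v i) y := by
  rw [eval_lineP, mixedEval]
  congr 2
  ext l
  cases l <;> simp

theorem eval_derivative_lineP_mixed (f : MvPolynomial ι R) (x y v : ι → A) (s : A) :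
    (derivative (lineP (mixed f) (Sum.elim x y) (Sum.elim v 0))).eval s =
      ∑ i, v i * mixedEval (MvPolynomial.pderiv i f) (fun i => x i + s * v i) y := by
  rw [derivative_lineP, Fintype.sum_sum_type, eval_add, eval_finsetSum, eval_finsetSum]
  simp only [Sum.elim_inl, Sum.elim_inr, Pi.zero_apply, C_0, zero_mul, eval_zero,
    Finset.sum_const_zero, add_zero, eval_mul, eval_C, pderiv_mixed, eval_lineP_mixed]

theorem mixedEval_map {S : Type*} [CommRing S] [Algebra R S] [Algebra S A] [IsScalarTower R S A]
    (f : MvPolynomial ι R) (x y : ι → A) :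
    mixedEval (MvPolynomial.map (algebraMap R S) f) x y = mixedEval f x y := by
  rw [mixedEval, ← map_mixed, MvPolynomial.aeval_map_algebraMap, mixedEval]

end Mixed

section Stability

variable {ι : Type*} [Fintype ι]

/-- The operators `1 - yⱼ ∂ⱼ` with `yⱼ` in the closed lower half-plane preserve stability. -/
theorem mixedEval_ne_zero {f : MvPolynomial ι ℂ}
    (hf : ∀ z : ι → ℂ, (∀ i, 0 < (z i).im) → MvPolynomial.aeval z f ≠ 0)
    (x y : ι → ℂ) (hx : ∀ i, 0 < (x i).im) (hy : ∀ i, (y i).im ≤ 0) : mixedEval f x y ≠ 0 := by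
  classical
  have key : ∀ S : Finset ι, ∀ x y : ι → ℂ, (∀ i, 0 < (x i).im) → (∀ i, (y i).im ≤ 0) →
      (∀ i, i ∉ S → y i = 0) → mixedEval f x y ≠ 0 := by
    intro S
    induction S using Finset.induction_on with
    | empty =>
      intro x y hx _ h0
      have : y = 0 := funext fun i => h0 i (by simp)
      rw [this, mixedEval_zero_right]
      exact hf x hx
    | insert i S hi ih =>
      intro x y hx hy h0 hz
      set y0 := Function.update y i 0 with hy0
      have hy0im : ∀ j, (y0 j).im ≤ 0 := fun j => by
        by_cases hj : j = i
        · subst hj; simp [hy0]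
        · simpa [hy0, Function.update_of_ne hj] using hy j
      have hy0S : ∀ j, j ∉ S → y0 j = 0 := fun j hj => by
        by_cases hji : j = i
        · subst hji; simp [hy0]
        · rw [hy0, Function.update_of_ne hji]
          exact h0 j (by simp [hji, hj])
      have hup := mixedEval_update f x y i (y i)
      rw [Function.update_eq_self, hz, ← hy0] at hup
      have hlog := im_logDeriv (q := lineP (mixed f) (Sum.elim x y0)
        (Sum.elim (Pi.single i 1) 0)) (fun s hs => by
          rw [eval_lineP_mixed]
          refine ih _ y0 (fun j => ?_) hy0im hy0S
          by_cases hj : j = i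
          · subst hj
            simpa using add_pos_of_pos_of_nonneg (hx j) hs
          · simpa [Pi.single_eq_of_ne hj] using hx j)
      rw [eval_derivative_lineP_mixed, eval_lineP_mixed] at hlog
      simp only [zero_mul, add_zero] at hlog
      rw [Finset.sum_eq_single i (fun j _ hj => by simp [Pi.single_eq_of_ne hj]) (by simp),
        Pi.single_eq_same, one_mul] at hlog
      have hne : mixedEval f x y0 ≠ 0 := ih x y0 hx hy0im hy0S
      rcases hlog with hlog | hlog
      · have hyi : y i ≠ 0 := by
          intro h
          rw [h, zero_mul, sub_zero] at hup
          exact hne hup.symm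
        have hquot : mixedEval (MvPolynomial.pderiv i f) x y0 / mixedEval f x y0 = (y i)⁻¹ := by
          rw [sub_eq_zero.1 hup.symm]
          have : mixedEval (MvPolynomial.pderiv i f) x y0 ≠ 0 := by
            intro h
            rw [h, mul_zero, sub_zero] at hup
            exact hne hup.symm
          field_simp
        rw [hquot, Complex.inv_im] at hlog
        have := div_nonneg (neg_nonneg.2 (hy i)) (Complex.normSq_nonneg (y i))
        linarith
      · rw [hlog, mul_zero, sub_zero] at hup
        exact hne hup.symm
  exact key Finset.univ x y hx hy (by simp)

theorem mixedEval_ne_zero_of_isStable {f : MvPolynomial ι ℝ} (hf : IsStable f)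
    (x y : ι → ℂ) (hx : ∀ i, 0 < (x i).im) (hy : ∀ i, (y i).im ≤ 0) : mixedEval f x y ≠ 0 := by
  rw [← mixedEval_map (S := ℂ)]
  refine mixedEval_ne_zero (fun z hz => ?_) x y hx hy
  rw [MvPolynomial.aeval_map_algebraMap]
  exact hf z hz

theorem mixedEval_eq_eval (f : MvPolynomial ι ℝ) (x y : ι → ℝ) :
    mixedEval f x y = MvPolynomial.eval (Sum.elim x y) (mixed f) := by
  rw [mixedEval, MvPolynomial.aeval_eq_eval]

theorem mixedEval_zero_right_eq_eval (f : MvPolynomial ι ℝ) (x : ι → ℝ) :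
    mixedEval f x 0 = MvPolynomial.eval x f := by
  rw [mixedEval_zero_right, MvPolynomial.aeval_eq_eval]

theorem aeval_lineP_mixed (f : MvPolynomial ι ℝ) (x y v : ι → ℝ) (z : ℂ) :
    aeval z (lineP (mixed f) (Sum.elim x y) (Sum.elim v 0)) =
      mixedEval f (fun l => (x l : ℂ) + z * v l) (fun l => (y l : ℂ)) := by
  rw [mixedEval, aeval_lineP]
  congr 2
  ext l
  cases l <;> simp

theorem hasDerivAt_mixedEval (f : MvPolynomial ι ℝ) (x y v : ι → ℝ) (s : ℝ) :
    HasDerivAt (fun s => mixedEval f (fun i => x i + s * v i) y)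
      (∑ i, v i * mixedEval (MvPolynomial.pderiv i f) (fun i => x i + s * v i) y) s := by
  have h := (lineP (mixed f) (Sum.elim x y) (Sum.elim v 0)).hasDerivAt s
  rw [eval_derivative_lineP_mixed] at h
  simpa only [eval_lineP_mixed] using h

theorem continuous_mixedEval (f : MvPolynomial ι ℝ) {T : Type*} [TopologicalSpace T]
    {a b : T → ι → ℝ} (ha : Continuous a) (hb : Continuous b) :
    Continuous fun s => mixedEval f (a s) (b s) := by
  have h : Continuous fun s => (Sum.elim (a s) (b s) : ι ⊕ ι → ℝ) := by
    refine continuous_pi fun l => ?_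
    cases l <;> simp only [Sum.elim_inl, Sum.elim_inr] <;> fun_prop
  simp only [mixedEval_eq_eval]
  exact (MvPolynomial.continuous_eval (mixed f)).comp h

/-- If `γ + w b` has no zeros in the upper half-plane for any `w` in the upper half-plane, then
`b / γ` maps the upper half-plane to the closed lower half-plane; so it is nonincreasing on the
real axis. -/
theorem derivative_mul_sub_le_zero {b γ : ℝ[X]}
    (h : ∀ z w : ℂ, 0 < z.im → 0 < w.im → aeval z γ + w * aeval z b ≠ 0) (x : ℝ) :
    b.derivative.eval x * γ.eval x - b.eval x * γ.derivative.eval x ≤ 0 := by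
  have hz : ∀ z : ℂ, 0 < z.im → (aeval z b * (starRingEnd ℂ) (aeval z γ)).im ≤ 0 := by
    intro z hz
    by_contra hcon
    rw [not_le] at hcon
    have hb : aeval z b ≠ 0 := fun h => by simp [h] at hcon
    have hn : 0 < Complex.normSq (aeval z b) := Complex.normSq_pos.2 hb
    refine h z (-(aeval z γ) / aeval z b) hz ?_ (by field_simp; ring)
    have : -(aeval z γ) / aeval z b = ((Complex.normSq (aeval z b))⁻¹ : ℝ) *
        -(starRingEnd ℂ) (aeval z b * (starRingEnd ℂ) (aeval z γ)) := by
      rw [div_eq_mul_inv, Complex.inv_def, map_mul, Complex.conj_conj]; push_cast; ring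
    rw [this, Complex.im_ofReal_mul]
    simp only [Complex.neg_im, Complex.conj_im, neg_neg]
    positivity
  have hder : ∀ p : ℝ[X], HasDerivAt (fun η : ℝ => aeval ((x : ℂ) + Complex.I * η) p)
      (Complex.I * (p.derivative.eval x : ℝ)) 0 := by
    intro p
    have h1 : HasDerivAt (fun η : ℝ => (x : ℂ) + Complex.I * η) Complex.I 0 := by
      simpa using ((hasDerivAt_id (0 : ℝ)).ofReal_comp.const_mul Complex.I).const_add (x : ℂ)
    have h2 := (p.hasDerivAt_aeval ((x : ℂ) + Complex.I * (0 : ℝ))).comp 0 h1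
    have h3 : aeval ((x : ℂ) + Complex.I * (0 : ℝ)) p.derivative = (p.derivative.eval x : ℝ) := by
      have := aeval_algebraMap_apply ℂ x p.derivative
      simpa using this
    rw [h3, mul_comm] at h2
    exact h2
  have hval : ∀ p : ℝ[X], aeval ((x : ℂ) + Complex.I * (0 : ℝ)) p = (p.eval x : ℝ) := fun p => by
    have := aeval_algebraMap_apply ℂ x p
    simpa using this
  have hconj : HasDerivAt (fun η : ℝ => (starRingEnd ℂ) (aeval ((x : ℂ) + Complex.I * η) γ))
      ((starRingEnd ℂ) (Complex.I * (γ.derivative.eval x : ℝ))) 0 :=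
    (Complex.conjCLE.toContinuousLinearMap.hasFDerivAt).comp_hasDerivAt 0 (hder γ)
  have hprod := (hder b).mul hconj
  have him := (Complex.imCLM.hasFDerivAt).comp_hasDerivAt 0 hprod
  have hlim := him.tendsto_slope_zero_right
  have hle : ∀ᶠ η : ℝ in 𝓝[>] 0, η⁻¹ • ((Complex.imCLM ∘ ((fun η : ℝ =>
      aeval ((x : ℂ) + Complex.I * η) b) * fun η : ℝ => (starRingEnd ℂ)
        (aeval ((x : ℂ) + Complex.I * η) γ))) (0 + η) - (Complex.imCLM ∘ ((fun η : ℝ =>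
      aeval ((x : ℂ) + Complex.I * η) b) * fun η : ℝ => (starRingEnd ℂ)
        (aeval ((x : ℂ) + Complex.I * η) γ))) 0) ≤ 0 := by
    filter_upwards [self_mem_nhdsWithin] with η hη
    have hη' : (0 : ℝ) < η := hη
    have h1 := hz ((x : ℂ) + Complex.I * (0 + η : ℝ)) (by simpa using hη')
    have h2 : (aeval ((x : ℂ) + Complex.I * (0 : ℝ)) b *
        (starRingEnd ℂ) (aeval ((x : ℂ) + Complex.I * (0 : ℝ)) γ)).im = 0 := by
      rw [hval, hval]; simp
    simp only [Function.comp_apply, Pi.mul_apply, Complex.imCLM_apply, smul_eq_mul]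
    rw [h2, sub_zero]
    exact mul_nonpos_of_nonneg_of_nonpos (inv_nonneg.2 hη'.le) h1
  have := le_of_tendsto hlim hle
  simp only [hval, Complex.imCLM_apply] at this
  simp at this
  linarith

end Stability

/-! ### Its hyperbolicity cone -/

theorem hasDerivAt_nonneg_of_right {f : ℝ → ℝ} {f' x : ℝ} (hf : HasDerivAt f f' x)
    (h : ∀ᶠ η in 𝓝[>] (0 : ℝ), f x ≤ f (x + η)) : 0 ≤ f' := by
  refine ge_of_tendsto hf.tendsto_slope_zero_right ?_
  filter_upwards [h, self_mem_nhdsWithin] with η h1 h2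
  exact smul_nonneg (inv_nonneg.2 (le_of_lt h2)) (sub_nonneg.2 h1)

theorem hasDerivAt_nonpos_of_left {f : ℝ → ℝ} {f' x : ℝ} (hf : HasDerivAt f f' x)
    (h : ∀ᶠ η in 𝓝[<] (0 : ℝ), f x ≤ f (x + η)) : f' ≤ 0 := by
  refine le_of_tendsto hf.tendsto_slope_zero_left ?_
  filter_upwards [h, self_mem_nhdsWithin] with η h1 h2
  exact smul_nonpos_of_nonpos_of_nonneg (inv_nonpos.2 (le_of_lt h2)) (sub_nonneg.2 h1)

theorem affine_nonneg_of_lt {p q ξ : ℝ} (hξ : 0 < ξ)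
    (h : ∀ b, 0 ≤ b → b < ξ → 0 ≤ p - b * q) : 0 ≤ p - ξ * q := by
  have hlim : Tendsto (fun b : ℝ => p - b * q) (𝓝[<] ξ) (𝓝 (p - ξ * q)) :=
    (Continuous.tendsto (by fun_prop) ξ).mono_left nhdsWithin_le_nhds
  refine ge_of_tendsto hlim ?_
  filter_upwards [Ioo_mem_nhdsLT hξ] with b hb
  exact h b hb.1.le hb.2

/-- The quotient rule as a monotonicity criterion on `[0, ∞)`. -/
theorem div_antitoneOn_of_derivative {b γ : ℝ[X]}
    (h : ∀ x, b.derivative.eval x * γ.eval x - b.eval x * γ.derivative.eval x ≤ 0)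
    (hpos : ∀ x, 0 ≤ x → 0 < γ.eval x) :
    AntitoneOn (fun x => b.eval x / γ.eval x) (Set.Ici 0) := by
  refine antitoneOn_of_deriv_nonpos (convex_Ici 0)
    (b.continuous.continuousOn.div γ.continuous.continuousOn fun x hx => (hpos x hx).ne')
    (fun x hx => ?_) fun x hx => ?_
  · rw [interior_Ici] at hx
    exact (b.differentiableAt.div γ.differentiableAt
      (hpos x (le_of_lt hx)).ne').differentiableWithinAt
  · rw [interior_Ici] at hx
    have h0 := hpos x (le_of_lt hx)
    rw [((b.hasDerivAt x).fun_div (γ.hasDerivAt x) h0.ne').deriv]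
    exact div_nonpos_of_nonpos_of_nonneg (h x) (by positivity)

section Cone

variable {ι : Type*} [Fintype ι]

/-- `(x, y)` lies in the closed hyperbolicity cone, with respect to the direction `(1, 0)`, of the
polynomial `∏ⱼ (1 - yⱼ ∂ⱼ) g(x)`. -/
def InCone (g : MvPolynomial ι ℝ) (x y : ι → ℝ) : Prop :=
  ∀ t : ℝ, 0 < t → 0 < mixedEval g (fun l => x l + t) y

variable {g : MvPolynomial ι ℝ} {D : ℕ}

theorem mixedEval_smul (hg : g.IsHomogeneous D) (c : ℝ) (x y : ι → ℝ) :
    mixedEval g (fun l => c * x l) (fun l => c * y l) = c ^ D * mixedEval g x y := by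
  rw [mixedEval, mixedEval, ← aeval_smul_of_isHomogeneous (isHomogeneous_mixed hg)]
  congr 2
  ext l
  cases l <;> rfl

/-- Nonvanishing suffices for membership in the cone: the point is joined to `(1, 0)`, where the
polynomial is positive, by a segment without zeros. -/
theorem inCone_of_ne_zero (hg : g.IsHomogeneous D) (h1 : 0 < MvPolynomial.eval (fun _ => 1) g)
    {x y : ι → ℝ} (h : ∀ t : ℝ, 0 < t → mixedEval g (fun l => x l + t) y ≠ 0) :
    InCone g x y := by
  intro t ht
  have key := pos_of_ne_zero_on_Icc
    (g := fun s => mixedEval g (fun l => (1 - s) + s * (x l + t)) (fun l => s * y l))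
    (continuous_mixedEval g (by fun_prop) (by fun_prop)) ?_ ?_
  · simpa using key
  · rintro s ⟨hs0, hs1⟩ hz
    rcases hs0.eq_or_lt with rfl | hs0
    · simp only [sub_zero, zero_mul, add_zero] at hz
      rw [show (fun _ : ι => (0 : ℝ)) = 0 from rfl, mixedEval_zero_right_eq_eval] at hz
      exact h1.ne' hz
    · have h2 := mixedEval_smul hg s (fun l => x l + (t + (1 - s) / s)) y
      have h3 : (fun l => s * (x l + (t + (1 - s) / s))) =
          fun l => (1 - s) + s * (x l + t) := by
        ext l; field_simp; ring
      rw [h3] at h2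
      rw [hz] at h2
      refine h (t + (1 - s) / s) ?_ ((mul_eq_zero.1 h2.symm).resolve_left (pow_ne_zero _ hs0.ne'))
      have : 0 ≤ (1 - s) / s := div_nonneg (by linarith) hs0.le
      linarith
  · simp only [sub_zero, zero_mul, add_zero]
    rw [show (fun _ : ι => (0 : ℝ)) = 0 from rfl, mixedEval_zero_right_eq_eval]
    exact h1

/-- Convexity of the hyperbolicity cone, from Gårding's theorem evaluated at a purely imaginary
point. -/
theorem inCone_sum (hg : g.IsHomogeneous D) (hst : IsStable g)
    (h1 : 0 < MvPolynomial.eval (fun _ => 1) g) {κ : Type*} (S : Finset κ) (X Y : κ → ι → ℝ)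
    (h : ∀ k, InCone g (X k) (Y k)) : InCone g (∑ k ∈ S, X k) (∑ k ∈ S, Y k) := by
  refine inCone_of_ne_zero hg h1 fun t ht hz => ?_
  refine aeval_ne_zero_of_mem_cone (isHomogeneous_mixed hg) (Sum.elim (fun _ => 1) (fun _ => 0))
    ?_ (fun k => Sum.elim (X k) (Y k)) ?_ S 0 (fun _ => Complex.I) (Complex.I * t) ?_ ?_ ?_
  · intro x z hz
    have := mixedEval_ne_zero_of_isStable hst (fun i => (x (Sum.inl i) : ℂ) + z)
      (fun i => (x (Sum.inr i) : ℂ)) (fun _ => by simpa using hz) (by simp)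
    have he : (fun l => (x l : ℂ) + z * (Sum.elim (fun _ : ι => (1 : ℝ)) (fun _ : ι => 0) l : ℝ)) =
        Sum.elim (fun i => (x (Sum.inl i) : ℂ) + z) (fun i => (x (Sum.inr i) : ℂ)) := by
      ext l
      cases l <;> simp
    rw [he]
    exact this
  · intro k t ht hz
    refine (h k t ht).ne' ?_
    rw [mixedEval_eq_eval, ← hz]
    congr 2
    ext l
    cases l <;> simp [add_comm]
  · simp
  · simpa using ht
  · have h2 := aeval_smul_of_isHomogeneous (isHomogeneous_mixed hg) Complex.I
      (fun l => ((Sum.elim (fun l => (∑ k ∈ S, X k) l + t) (∑ k ∈ S, Y k) l : ℝ) : ℂ))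
    rw [aeval_ofReal] at h2
    rw [mixedEval_eq_eval] at hz
    rw [hz, Complex.ofReal_zero, mul_zero] at h2
    rw [← h2]
    congr 2
    ext l
    cases l <;> simp [Finset.mul_sum, mul_add]

theorem InCone.add (hg : g.IsHomogeneous D) (hst : IsStable g)
    (h1 : 0 < MvPolynomial.eval (fun _ => 1) g) {x y x' y' : ι → ℝ} (h : InCone g x y)
    (h' : InCone g x' y') : InCone g (x + x') (y + y') := by
  have := inCone_sum hg hst h1 Finset.univ ![x, x'] ![y, y'] (by
    intro k; fin_cases k <;> assumption)
  simpa [Fin.sum_univ_two] using this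

theorem InCone.smul (hg : g.IsHomogeneous D) {x y : ι → ℝ} (h : InCone g x y) {c : ℝ}
    (hc : 0 < c) : InCone g (fun l => c * x l) (fun l => c * y l) := by
  intro t ht
  have h2 := mixedEval_smul hg c (fun l => x l + t / c) y
  have h3 : (fun l => c * (x l + t / c)) = fun l => c * x l + t := by ext l; field_simp
  rw [h3] at h2
  rw [h2]
  exact mul_pos (pow_pos hc _) (h _ (div_pos ht hc))

theorem InCone.nonneg {x y : ι → ℝ} (h : InCone g x y) : 0 ≤ mixedEval g x y := by
  have hc : Continuous fun t : ℝ => mixedEval g (fun l => x l + t) y :=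
    continuous_mixedEval g (by fun_prop) (by fun_prop)
  have hlim := (hc.tendsto 0).mono_left (nhdsWithin_le_nhds (s := Set.Ioi 0))
  simp only [add_zero] at hlim
  refine ge_of_tendsto hlim ?_
  filter_upwards [self_mem_nhdsWithin] with t ht
  exact (h t ht).le

theorem inCone_zero_right (hg : IsPosHurwitz D g) {x : ι → ℝ} (hx : ∀ i, 0 ≤ x i) :
    InCone g x 0 := by
  intro t ht
  rw [mixedEval_zero_right_eq_eval]
  exact hg.pos _ fun i => by linarith [hx i]

theorem inCone_neg_single [DecidableEq ι] (hg : IsPosHurwitz D g) (i : ι) {b : ℝ} (hb : 0 ≤ b) :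
    InCone g 0 (Function.update 0 i (-b)) := by
  intro t ht
  have h0 : Function.update (0 : ι → ℝ) i (0 : ℝ) = 0 :=
    Function.update_eq_self_iff.2 rfl
  rw [mixedEval_update, h0, mixedEval_zero_right_eq_eval,
    mixedEval_zero_right_eq_eval]
  have h1 := hg.pos (fun l => (0 : ι → ℝ) l + t) (fun i => by simpa using ht)
  have h2 : 0 ≤ MvPolynomial.eval (fun l => (0 : ι → ℝ) l + t) (MvPolynomial.pderiv i g) :=
    iteratedNonneg_pderiv (iteratedNonneg_of_isPosHurwitz hg) i 0 _ (fun i => by simpa using ht)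
  have := mul_nonneg hb h2
  linarith

theorem InCone.mono (hg : IsPosHurwitz D g) (hst : IsStable g) {x x' y : ι → ℝ}
    (h : InCone g x y) (hx : ∀ i, x i ≤ x' i) : InCone g x' y := by
  have := h.add hg.homogeneous hst (hg.pos (fun _ => 1) fun _ => one_pos)
    (inCone_zero_right hg (x := x' - x) fun i => sub_nonneg.2 (hx i))
  simpa using this

theorem InCone.pos (hg : IsPosHurwitz D g) (hst : IsStable g) {x x' y : ι → ℝ}
    (h : InCone g x y) {t : ℝ} (ht : 0 < t) (hx : ∀ i, x i + t ≤ x' i) :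
    0 < mixedEval g x' y := by
  have := h.mono hg hst (x' := fun i => x' i - t) (fun i => by linarith [hx i]) t ht
  simpa using this

theorem mixedEval_update_of_eq_zero [DecidableEq ι] (f : MvPolynomial ι ℝ) (x : ι → ℝ)
    {y : ι → ℝ} {i : ι} (hy : y i = 0) (c : ℝ) : mixedEval f x (Function.update y i c) =
      mixedEval f x y - c * mixedEval (MvPolynomial.pderiv i f) x y := by
  rw [mixedEval_update, (Function.update_eq_self_iff (f := y) (a := i)).2 hy.symm]

/-- Raising one `y`-coordinate while keeping `∏ⱼ (1 - yⱼ ∂ⱼ) g` positive at the given point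
does not leave the cone. -/
theorem inCone_update_of_lt [DecidableEq ι] (hst : IsStable g) {x y : ι → ℝ} {i : ι}
    (hy : y i = 0) (h : InCone g x y) {b : ℝ} (hb : 0 ≤ b) (h0 : 0 < mixedEval g x y)
    (hlt : b * mixedEval (MvPolynomial.pderiv i g) x y < mixedEval g x y) :
    InCone g x (Function.update y i b) := by
  intro t ht
  rw [mixedEval_update_of_eq_zero g _ hy]
  have hanti := div_antitoneOn_of_derivative
    (b := lineP (mixed (MvPolynomial.pderiv i g)) (Sum.elim x y) (Sum.elim (fun _ => 1) 0))
    (γ := lineP (mixed g) (Sum.elim x y) (Sum.elim (fun _ => 1) 0))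
    (derivative_mul_sub_le_zero fun z w hz hw => by
      rw [aeval_lineP_mixed, aeval_lineP_mixed]
      simp only [Complex.ofReal_one, mul_one]
      have h3 := mixedEval_update g (fun l => (x l : ℂ) + z) (fun l => (y l : ℂ)) i (-w)
      have h4 : Function.update (fun l => (y l : ℂ)) i 0 = fun l => (y l : ℂ) :=
        Function.update_eq_self_iff.2 (by simp [hy])
      rw [h4] at h3
      have h5 := mixedEval_ne_zero_of_isStable hst (fun l => (x l : ℂ) + z)
        (Function.update (fun l => (y l : ℂ)) i (-w)) (fun _ => by simpa using hz) (fun l => by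
          by_cases hl : l = i
          · subst hl; simpa using hw.le
          · simp [Function.update_of_ne hl])
      rw [h3] at h5
      simpa using h5) (fun s hs => by
        rw [eval_lineP_mixed]
        rcases hs.eq_or_lt with rfl | hs
        · simpa using h0
        · simpa using h s hs)
  have := hanti (Set.mem_Ici.2 le_rfl) (Set.mem_Ici.2 ht.le) ht.le
  simp only [eval_lineP_mixed, mul_one, add_zero] at this
  have ht0 := h t ht
  rw [div_le_div_iff₀ ht0 h0] at this
  have h5 := mul_le_mul_of_nonneg_left this hb
  by_contra hcon
  nlinarith [mul_pos ht0 (sub_pos.2 hlt)]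

end Cone

/-! ### The barrier argument -/

/-- The elementary inequality at the end of the barrier argument, for `A = g`, `B = ∂ᵢ g`,
`A₁ = ∂ⱼ g`, `B₁ = ∂ⱼ ∂ᵢ g`. -/
theorem barrier_inequality {A B A₁ B₁ a δ : ℝ} (hA : 0 < A) (hB : 0 < B) (ha : 0 ≤ a)
    (haB : a * B < A) (hδ : A < δ * (A - A₁)) (hδ1 : 1 < δ) (hW : 0 ≤ A₁ * B - A * B₁)
    (htan : δ * (A₁ * B - A * B₁) ≤ (A - a * B) * B) : 0 < (A - A₁) - a * (B - B₁) := by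
  have hAA : 0 < A - A₁ := by
    by_contra h
    nlinarith
  rcases le_or_gt (B - B₁) 0 with hle | hgt
  · nlinarith [mul_nonneg ha (neg_nonneg.2 hle)]
  rcases hW.eq_or_lt with h0 | hW
  · have h1 : 0 < (A - a * B) * (B - B₁) := mul_pos (sub_pos.2 haB) hgt
    have h2 : 0 < B * ((A - A₁) - a * (B - B₁)) := by nlinarith
    exact pos_of_mul_pos_right h2 hB.le
  · have h1 : 0 < A * (δ * B - B - δ * B₁) := by
      have : A * (δ * B - B - δ * B₁) =
        B * (δ * (A - A₁) - A) + δ * (A₁ * B - A * B₁) := by ring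
      rw [this]
      have h3 := mul_pos hB (sub_pos.2 hδ)
      have h4 := mul_pos (zero_lt_one.trans hδ1) hW
      linarith
    have h2 : 0 < δ * B - B - δ * B₁ := pos_of_mul_pos_right h1 hA.le
    have h3 := mul_pos hW h2
    have h4 := mul_le_mul_of_nonneg_right htan hgt.le
    have h5 : 0 < B * B * ((A - A₁) - a * (B - B₁)) := by nlinarith
    exact pos_of_mul_pos_right h5 (by positivity)

section Barrier

variable {ι : Type*} [Fintype ι] [DecidableEq ι] {g : MvPolynomial ι ℝ} {D : ℕ}

/-- The barrier lemma: applying the operator `1 - ∂ⱼ` at the cost of a shift by `δ` in the `j`-th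
coordinate preserves the room `a` left for the operator `1 - a ∂ᵢ`. -/
theorem InCone.barrier (hg : IsPosHurwitz D g) (hst : IsStable g) {i j : ι} (hij : i ≠ j)
    {x y : ι → ℝ} (hyi : y i = 0) (hyj : y j = 0) {a δ c : ℝ} (ha : 0 ≤ a) (hδ : 1 < δ)
    (hc : c * (δ - 1) = δ) (h1 : InCone g x (Function.update y i a))
    (h2 : InCone g x (Function.update y j c)) :
    InCone g (x + Pi.single j δ) (Function.update (Function.update y i a) j 1) := by
  intro t ht
  have hg1 : 0 < MvPolynomial.eval (fun _ => 1) g := hg.pos (fun _ => 1) fun _ => one_pos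
  set X : ℝ → ι → ℝ := fun s l => (x l + t) + s * Pi.single (M := fun _ => ℝ) j 1 l with hX
  set A : ℝ → ℝ := fun s => mixedEval g (X s) y with hA
  set B : ℝ → ℝ := fun s => mixedEval (MvPolynomial.pderiv i g) (X s) y with hB
  set A₁ : ℝ → ℝ := fun s => mixedEval (MvPolynomial.pderiv j g) (X s) y with hA₁
  set B₁ : ℝ → ℝ := fun s =>
    mixedEval (MvPolynomial.pderiv j (MvPolynomial.pderiv i g)) (X s) y with hB₁
  have hder : ∀ f : MvPolynomial ι ℝ, ∀ s, HasDerivAt (fun s => mixedEval f (X s) y)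
      (mixedEval (MvPolynomial.pderiv j f) (X s) y) s := by
    intro f s
    have := hasDerivAt_mixedEval f (fun l => x l + t) y (Pi.single j 1) s
    rwa [Finset.sum_eq_single j (fun l _ hl => by simp [Pi.single_eq_of_ne hl]) (by simp),
      Pi.single_eq_same, one_mul] at this
  have hdA : ∀ s, HasDerivAt A (A₁ s) s := hder g
  have hdB : ∀ s, HasDerivAt B (B₁ s) s := hder _
  have hXle : ∀ s, 0 ≤ s → ∀ l, x l + t ≤ X s l := fun s hs l => by
    have : (0 : ℝ) ≤ Pi.single (M := fun _ => ℝ) j 1 l := by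
      by_cases hl : l = j
      · subst hl; simp
      · simp [Pi.single_eq_of_ne hl]
    have := mul_nonneg hs this
    simp only [hX]; linarith
  have hXmono : ∀ s s', s ≤ s' → ∀ l, X s l ≤ X s' l := fun s s' hs l => by
    have : (0 : ℝ) ≤ Pi.single (M := fun _ => ℝ) j 1 l := by
      by_cases hl : l = j
      · subst hl; simp
      · simp [Pi.single_eq_of_ne hl]
    have := mul_le_mul_of_nonneg_right hs this
    simp only [hX]; linarith
  have hui : ∀ s b, mixedEval g (X s) (Function.update y i b) = A s - b * B s := fun s b =>
    mixedEval_update_of_eq_zero g _ hyi b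
  have huj : ∀ s b, mixedEval g (X s) (Function.update y j b) = A s - b * A₁ s := fun s b =>
    mixedEval_update_of_eq_zero g _ hyj b
  have hAaB : ∀ s, 0 ≤ s → 0 < A s - a * B s := fun s hs => by
    rw [← hui]; exact h1.pos hg hst ht (hXle s hs)
  have hdown : ∀ b, 0 ≤ b → InCone g x (Function.update y i (-b)) := by
    intro b hb
    have := h1.add hg.homogeneous hst hg1 (inCone_neg_single hg i (add_nonneg ha hb))
    convert this using 1
    · simp
    · ext l
      by_cases hl : l = i
      · subst hl; simp
      · simp [Function.update_of_ne hl]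
  have hyC : InCone g x y := by
    have := hdown 0 le_rfl
    rwa [neg_zero, Function.update_eq_self_iff.2 hyi.symm] at this
  have hApos : ∀ s, 0 ≤ s → 0 < A s := fun s hs => hyC.pos hg hst ht (hXle s hs)
  have hBnn : ∀ s, 0 ≤ s → 0 ≤ B s := by
    intro s hs
    by_contra hneg
    rw [not_le] at hneg
    have := (hdown (A s / -B s) (div_nonneg (hApos s hs).le (by linarith))).pos hg hst ht
      (hXle s hs)
    rw [hui, neg_mul, sub_neg_eq_add, div_mul_eq_mul_div, div_neg, mul_div_assoc,
      div_self hneg.ne] at this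
    linarith
  have hδ0 : 0 < δ := by linarith
  have hAδ : A δ < δ * (A δ - A₁ δ) := by
    have h3 : 0 < A δ - c * A₁ δ := by
      rw [← huj]; exact h2.pos hg hst ht (hXle δ hδ0.le)
    have h4 := mul_pos h3 (sub_pos.2 hδ)
    have h5 : (A δ - c * A₁ δ) * (δ - 1) = δ * (A δ - A₁ δ) - A δ := by
      linear_combination -(A₁ δ) * hc
    linarith
  have hgoal : mixedEval g (fun l => (x + Pi.single j δ : ι → ℝ) l + t)
      (Function.update (Function.update y i a) j 1) = (A δ - A₁ δ) - a * (B δ - B₁ δ) := by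
    have hx : (fun l => (x + Pi.single j δ : ι → ℝ) l + t) = X δ := by
      ext l
      by_cases hl : l = j
      · subst hl; simp [hX]; ring
      · simp [hX, Pi.single_eq_of_ne hl]
    rw [hx, Function.update_comm hij, mixedEval_update_of_eq_zero g _
      (by rw [Function.update_of_ne hij, hyi]) a, huj,
      mixedEval_update_of_eq_zero _ _ hyj 1]
    simp only [hB, hB₁]
    ring
  rw [hgoal]
  rcases (hBnn δ hδ0.le).eq_or_lt with hB0 | hBpos
  · have hmin : IsLocalMin B δ := by
      filter_upwards [lt_mem_nhds hδ0] with s hs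
      rw [← hB0]; exact hBnn s (le_of_lt hs)
    have hB10 : B₁ δ = 0 := hmin.hasDerivAt_eq_zero (hdB δ)
    rw [← hB0, hB10]
    have := hApos δ hδ0.le
    nlinarith
  -- `ξ` is the boundary value of the `i`-th `y`-coordinate at the shifted point.
  set ξ := A δ / B δ with hξ
  have hξpos : 0 < ξ := div_pos (hApos δ hδ0.le) hBpos
  have hξB : ξ * B δ = A δ := div_mul_cancel₀ _ hBpos.ne'
  have hbelow : ∀ b, 0 ≤ b → b < ξ → InCone g (X δ) (Function.update y i b) := by
    intro b hb hbξ
    refine inCone_update_of_lt hst hyi (hyC.mono hg hst fun l => ?_) hb (hApos δ hδ0.le) ?_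
    · linarith [hXle δ hδ0.le l]
    · calc b * B δ < ξ * B δ := mul_lt_mul_of_pos_right hbξ hBpos
        _ = A δ := hξB
  -- Moving up in direction `j` from the boundary point `(X δ, ξ)` stays in the cone.
  have hup : 0 ≤ A₁ δ - ξ * B₁ δ := by
    refine hasDerivAt_nonneg_of_right (f := fun s => A s - ξ * B s)
      ((hdA δ).sub ((hdB δ).const_mul ξ)) ?_
    filter_upwards [self_mem_nhdsWithin] with η hη
    have hη' : (0 : ℝ) < η := hη
    rw [hξB, sub_self]
    refine affine_nonneg_of_lt hξpos fun b hb hbξ => ?_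
    rw [← hui]
    exact ((hbelow b hb hbξ).mono hg hst (hXmono δ (δ + η) (by linarith))).nonneg
  -- So does the segment from `(X 0, a)` to `(X δ, ξ)`, by convexity.
  have hseg : δ * A₁ δ - ((ξ - a) * B δ + ξ * (δ * B₁ δ)) ≤ 0 := by
    have hd1 : HasDerivAt (fun θ : ℝ => θ * δ) δ 1 := by
      simpa using (hasDerivAt_id (1 : ℝ)).mul_const δ
    have hAθ : HasDerivAt (fun θ => A (θ * δ)) (A₁ δ * δ) 1 :=
      HasDerivAt.comp (h₂ := A) (h := fun θ : ℝ => θ * δ) (h₂' := A₁ δ) 1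
        (by rw [one_mul]; exact hdA δ) hd1
    have hBθ : HasDerivAt (fun θ => B (θ * δ)) (B₁ δ * δ) 1 :=
      HasDerivAt.comp (h₂ := B) (h := fun θ : ℝ => θ * δ) (h₂' := B₁ δ) 1
        (by rw [one_mul]; exact hdB δ) hd1
    have hlin : HasDerivAt (fun θ : ℝ => (1 - θ) * a + θ * ξ) (ξ - a) 1 := by
      exact ((((hasDerivAt_id (1 : ℝ)).const_sub 1).mul_const a).add
        ((hasDerivAt_id (1 : ℝ)).mul_const ξ)).congr_deriv (by ring)
    have hF := hAθ.sub (hlin.mul hBθ)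
    have hle := hasDerivAt_nonpos_of_left hF ?_
    · simp only [one_mul, sub_self, zero_mul, zero_add] at hle
      linarith
    · filter_upwards [Ioo_mem_nhdsLT (show (-1 : ℝ) < 0 by norm_num)] with η hη
      simp only [Pi.sub_apply, Pi.mul_apply, one_mul, sub_self, zero_mul, zero_add]
      rw [hξB, sub_self]
      obtain ⟨θ, hθ⟩ : ∃ θ, θ = 1 + η := ⟨_, rfl⟩
      have hθ0 : 0 < θ := by linarith [hη.1]
      have hθ1 : 0 < 1 - θ := by linarith [hη.2]
      rw [← hθ]
      have haff := affine_nonneg_of_lt (p := A (θ * δ) - (1 - θ) * a * B (θ * δ))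
        (q := θ * B (θ * δ)) hξpos fun b hb hbξ => ?_
      · linarith
      have hP := ((h1.mono hg hst (x' := X 0) fun l => by
        linarith [hXle 0 le_rfl l]).smul hg.homogeneous hθ1).add hg.homogeneous hst hg1
          ((hbelow b hb hbξ).smul hg.homogeneous hθ0)
      have e1 : ((fun l => (1 - θ) * X 0 l) + fun l => θ * X δ l) = X (θ * δ) := by
        ext l; simp only [hX, Pi.add_apply]; ring
      have e2 : ((fun l => (1 - θ) * Function.update y i a l) + fun l =>
          θ * Function.update y i b l) = Function.update y i ((1 - θ) * a + θ * b) := by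
        ext l
        by_cases hl : l = i
        · subst hl; simp
        · simp only [Pi.add_apply, Function.update_of_ne hl]; ring
      rw [e1, e2] at hP
      have := hP.nonneg
      rw [hui] at this
      linarith
  refine barrier_inequality (hApos δ hδ0.le) hBpos ha (sub_pos.1 (hAaB δ hδ0.le)) hAδ hδ ?_ ?_
  · have := mul_nonneg hup hBpos.le
    have e : (A₁ δ - ξ * B₁ δ) * B δ = A₁ δ * B δ - A δ * B₁ δ := by
      linear_combination -(B₁ δ) * hξB
    rwa [e] at this
  · have := mul_nonneg (neg_nonneg.2 hseg) hBpos.le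
    have e : -(δ * A₁ δ - ((ξ - a) * B δ + ξ * (δ * B₁ δ))) * B δ =
        (A δ - a * B δ) * B δ - δ * (A₁ δ * B δ - A δ * B₁ δ) := by
      linear_combination (B δ + δ * B₁ δ) * hξB
    rw [e] at this
    linarith

/-- Iterating the barrier lemma: the coordinates in `S` have been processed. -/
theorem inCone_iterate (hg : IsPosHurwitz D g) (hst : IsStable g) {t δ c : ℝ} (hδ : 1 < δ)
    (hc : c * (δ - 1) = δ) (h0 : ∀ i, InCone g (fun _ => t) (Function.update 0 i c))
    (S : Finset ι) (i : ι) (hi : i ∉ S) :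
    InCone g (fun l => t + if l ∈ S then δ else 0)
      (Function.update (fun l => if l ∈ S then 1 else 0) i c) := by
  induction S using Finset.induction_on generalizing i with
  | empty => simpa [Pi.zero_def] using h0 i
  | insert j S hj ih =>
    rw [Finset.mem_insert, not_or] at hi
    have hc0 : 0 ≤ c := by
      by_contra h
      nlinarith
    have := InCone.barrier hg hst hi.1 (by simp [hi.2]) (by simp [hj]) hc0 hδ hc
      (ih i hi.2) (ih j hj)
    convert this using 1
    · ext l
      by_cases hl : l = j
      · subst hl; simp [hj]
      · simp [hl]
    · ext l
      by_cases hl : l = j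
      · subst hl; simp [Function.update_of_ne (Ne.symm hi.1)]
      · by_cases hli : l = i
        · subst hli; simp [Function.update_of_ne hl]
        · simp [Function.update_of_ne hli, hl]

/-- Averaging over the coordinate that is processed last. -/
theorem inCone_average [Nonempty ι] (hg : IsPosHurwitz D g) (hst : IsStable g) {t δ c : ℝ}
    (hδ : 1 < δ) (hc : c * (δ - 1) = δ)
    (h0 : ∀ i, InCone g (fun _ => t) (Function.update 0 i c)) :
    InCone g (fun _ => (Fintype.card ι * t + (Fintype.card ι - 1) * δ) /
      (Fintype.card ι - 1 + c)) (fun _ => 1) := by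
  have hcard : (1 : ℝ) ≤ Fintype.card ι := by exact_mod_cast Fintype.card_pos
  have hc0 : 0 < c := by
    by_contra h
    nlinarith
  have h1 := inCone_sum hg.homogeneous hst (hg.pos (fun _ => 1) fun _ => one_pos) Finset.univ _ _
    (fun i => inCone_iterate hg hst hδ hc h0 (Finset.univ.erase i) i (Finset.notMem_erase i _))
  have hN : 0 < (Fintype.card ι : ℝ) - 1 + c := by linarith
  have h2 := h1.smul hg.homogeneous (inv_pos.2 hN)
  have e0 : ∀ l : ι, ∀ p q : ℝ, ∑ i : ι, (if l = i then p else q) =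
      p + (Fintype.card ι - 1) * q := by
    intro l p q
    have : ∀ i : ι, (if l = i then p else q) = q + if l = i then p - q else 0 := by
      intro i; split_ifs <;> ring
    simp only [this, Finset.sum_add_distrib, Finset.sum_const, Finset.card_univ, nsmul_eq_mul,
      Finset.sum_ite_eq, Finset.mem_univ, if_true]
    ring
  convert h2 using 1
  · ext l
    rw [Finset.sum_apply]
    have : ∀ i, (t + if l ∈ Finset.univ.erase i then δ else 0) = if l = i then t else t + δ := by
      intro i; by_cases h : l = i <;> simp [h]
    simp only [this, e0]
    field_simp
    ring
  · ext l
    rw [Finset.sum_apply]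
    have : ∀ i, Function.update (fun l => if l ∈ Finset.univ.erase i then (1 : ℝ) else 0) i c l =
        if l = i then c else 1 := by
      intro i
      by_cases h : l = i
      · subst h; simp
      · simp [h]
    simp only [this, e0]
    field_simp
    ring

end Barrier

/-! ### Choosing the colours one at a time -/

/-- If `q' < q` on `[0, ∞)`, then `q e⁻ˢ` decreases to `0`, so `q` is positive. -/
theorem eval_zero_pos_of_derivative_lt {q : ℝ[X]}
    (h : ∀ s, 0 ≤ s → q.derivative.eval s < q.eval s) : 0 < q.eval 0 := by
  have hd : ∀ s, HasDerivAt (fun s => q.eval s / Real.exp s)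
      ((q.derivative.eval s * Real.exp s - q.eval s * Real.exp s) / Real.exp s ^ 2) s := fun s =>
    (q.hasDerivAt s).fun_div (Real.hasDerivAt_exp s) (Real.exp_pos s).ne'
  have hanti : StrictAntiOn (fun s => q.eval s / Real.exp s) (Set.Ici 0) := by
    refine strictAntiOn_of_deriv_neg (convex_Ici 0)
      (fun s _ => (hd s).continuousAt.continuousWithinAt) fun s hs => ?_
    rw [interior_Ici] at hs
    rw [(hd s).deriv]
    refine div_neg_of_neg_of_pos ?_ (by positivity)
    nlinarith [h s (le_of_lt hs), Real.exp_pos s]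
  have h1 : 0 ≤ q.eval 1 / Real.exp 1 := by
    refine le_of_tendsto (Polynomial.tendsto_div_exp_atTop q) ?_
    filter_upwards [eventually_ge_atTop 1] with s hs
    exact hanti.antitoneOn (Set.mem_Ici.2 zero_le_one) (Set.mem_Ici.2 (zero_le_one.trans hs)) hs
  have h2 := hanti (Set.mem_Ici.2 le_rfl) (Set.mem_Ici.2 zero_le_one) zero_lt_one
  simp only [Real.exp_zero, div_one] at h2
  linarith

/-- The translate `x ↦ p(x - a)`. -/
noncomputable def shift {ι : Type*} (a : ι → ℝ) (p : MvPolynomial ι ℝ) : MvPolynomial ι ℝ :=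
  MvPolynomial.aeval (fun i => MvPolynomial.X i - MvPolynomial.C (a i)) p

theorem aeval_shift {ι A : Type*} [CommRing A] [Algebra ℝ A] (a : ι → ℝ) (p : MvPolynomial ι ℝ)
    (x : ι → A) : MvPolynomial.aeval x (shift a p) =
      MvPolynomial.aeval (fun i => x i - algebraMap ℝ A (a i)) p := by
  unfold shift
  induction p using MvPolynomial.induction_on with
  | C a => simp [MvPolynomial.algebraMap_eq]
  | add p q hp hq => simp only [map_add, hp, hq]
  | mul_X p i hp => simp only [map_mul, hp, MvPolynomial.aeval_X, map_sub, MvPolynomial.algHom_C]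

theorem isStable_shift {ι : Type*} {p : MvPolynomial ι ℝ} (hp : IsStable p) (a : ι → ℝ) :
    IsStable (shift a p) := by
  intro z hz
  rw [aeval_shift]
  exact hp _ fun i => by simpa using hz i

theorem pderiv_shift {ι : Type*} (a : ι → ℝ) (p : MvPolynomial ι ℝ) (i : ι) :
    MvPolynomial.pderiv i (shift a p) = shift a (MvPolynomial.pderiv i p) := by
  unfold shift
  induction p using MvPolynomial.induction_on with
  | C a => simp [MvPolynomial.algebraMap_eq]
  | add p q hp hq => simp only [map_add, hp, hq]
  | mul_X p j hp =>
    simp only [map_mul, MvPolynomial.aeval_X, MvPolynomial.pderiv_mul, hp, map_add, map_sub,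
      MvPolynomial.pderiv_C, sub_zero]
    congr 2
    by_cases h : j = i
    · subst h; simp
    · simp [MvPolynomial.pderiv_X_of_ne h]

theorem pderiv_prod {ι κ : Type*} [DecidableEq κ] (S : Finset κ) (P : κ → MvPolynomial ι ℝ)
    (i : ι) :
    MvPolynomial.pderiv i (∏ j ∈ S, P j) =
      ∑ j ∈ S, MvPolynomial.pderiv i (P j) * ∏ l ∈ S.erase j, P l := by
  induction S using Finset.induction_on with
  | empty => simp
  | insert j S hj ih =>
    rw [Finset.prod_insert hj, MvPolynomial.pderiv_mul, ih, Finset.sum_insert hj,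
      Finset.erase_insert hj, Finset.mul_sum]
    congr 1
    refine Finset.sum_congr rfl fun l hl => ?_
    have hjl : j ≠ l := fun h => hj (h ▸ hl)
    rw [Finset.erase_insert_of_ne hjl, Finset.prod_insert fun h => hj (Finset.mem_of_mem_erase h)]
    ring

section Selection

variable {ι : Type*} [Fintype ι] [DecidableEq ι]

/-- A polynomial with vanishing second derivative in the `i`-th variable is affine in it. -/
theorem aeval_add_single {A : Type*} [Field A] [CharZero A] [Algebra ℝ A]
    {p : MvPolynomial ι ℝ} {i : ι} (hp : MvPolynomial.pderiv i (MvPolynomial.pderiv i p) = 0)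
    (x : ι → A) (s : A) :
    MvPolynomial.aeval (fun l => x l + s * Pi.single (M := fun _ => A) i 1 l) p =
      MvPolynomial.aeval x p + s * MvPolynomial.aeval x (MvPolynomial.pderiv i p) := by
  have hder : ∀ f : MvPolynomial ι ℝ, derivative (lineP f x (Pi.single i 1)) =
      lineP (MvPolynomial.pderiv i f) x (Pi.single i 1) := fun f => by
    rw [derivative_lineP, Finset.sum_eq_single i (fun l _ hl => by simp [Pi.single_eq_of_ne hl])
      (by simp), Pi.single_eq_same, C_1, one_mul]
  set q := lineP p x (Pi.single i 1) with hq
  have h2 : derivative (derivative q) = 0 := by rw [hder, hder, hp]; simp [lineP]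
  have h3 := derivative_eq_zero.1 h2
  obtain ⟨b, hb⟩ := natDegree_eq_zero.1 h3
  have h4 : derivative (q - C b * X) = 0 := by simp [← hb]
  obtain ⟨b', hb'⟩ := natDegree_eq_zero.1 (derivative_eq_zero.1 h4)
  have hqe : q = C b' + C b * X := by rw [hb']; ring
  have e1 : q.eval s = b' + b * s := by rw [hqe]; simp
  have e0 : q.eval 0 = b' := by rw [hqe]; simp
  have ed : (derivative q).eval 0 = b := by rw [← hb]; simp
  rw [hder] at ed
  rw [hq, eval_lineP] at e1 e0
  rw [eval_lineP] at ed
  simp only [zero_mul, add_zero] at e0 ed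
  rw [e1, ← e0, ← ed]
  ring

variable {k : ℕ}

/-- The product over the colours `j` of `p(x - k 1_{Sⱼ})`, where `Sⱼ` is the set of those elements
outside `R` that `c` colours with `j`. -/
noncomputable def colourProd (p : MvPolynomial ι ℝ) (c : ι → Fin k) (R : Finset ι) :
    MvPolynomial ι ℝ :=
  ∏ j, shift (fun l => if l ∉ R ∧ c l = j then (k : ℝ) else 0) p

theorem colourProd_update {p : MvPolynomial ι ℝ}
    (hp : ∀ i, MvPolynomial.pderiv i (MvPolynomial.pderiv i p) = 0) (c : ι → Fin k)
    {R : Finset ι} {i : ι} (hi : i ∉ R) (j : Fin k) :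
    colourProd p (Function.update c i j) R = colourProd p c (insert i R) -
      MvPolynomial.C (k : ℝ) * (MvPolynomial.pderiv i
        (shift (fun l => if l ∉ insert i R ∧ c l = j then (k : ℝ) else 0) p) *
        ∏ l ∈ Finset.univ.erase j,
          shift (fun l' => if l' ∉ insert i R ∧ c l' = l then (k : ℝ) else 0) p) := by
  have h1 : shift (fun l => if l ∉ R ∧ Function.update c i j l = j then (k : ℝ) else 0) p =
      shift (fun l => if l ∉ insert i R ∧ c l = j then (k : ℝ) else 0) p - MvPolynomial.C (k : ℝ) *
        MvPolynomial.pderiv i (shift (fun l => if l ∉ insert i R ∧ c l = j then (k : ℝ) else 0) p)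
      := by
    refine MvPolynomial.funext fun x => ?_
    have he : ∀ f : MvPolynomial ι ℝ, MvPolynomial.eval x f = MvPolynomial.aeval x f := fun f => by
      rw [MvPolynomial.aeval_eq_eval]
    rw [map_sub, map_mul, MvPolynomial.eval_C, pderiv_shift, he, he, he, aeval_shift, aeval_shift,
      aeval_shift, sub_eq_add_neg, ← neg_mul, ← aeval_add_single (hp i)]
    congr 2
    ext l
    by_cases hl : l = i
    · subst hl; simp [hi, sub_eq_add_neg]
    · simp [hl]
  have h2 : ∏ l ∈ Finset.univ.erase j,
      shift (fun l' => if l' ∉ R ∧ Function.update c i j l' = l then (k : ℝ) else 0) p =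
      ∏ l ∈ Finset.univ.erase j,
        shift (fun l' => if l' ∉ insert i R ∧ c l' = l then (k : ℝ) else 0) p := by
    refine Finset.prod_congr rfl fun l hl => ?_
    congr 1
    ext l'
    by_cases hl' : l' = i
    · subst hl'
      have : j ≠ l := (Finset.ne_of_mem_erase hl).symm
      simp [this]
    · simp [hl']
  unfold colourProd
  rw [← Finset.mul_prod_erase _ _ (Finset.mem_univ j), h2, h1,
    ← Finset.mul_prod_erase (a := j) _ _ (Finset.mem_univ j), ← mul_assoc, ← sub_mul]

/-- One step of the method of interlacing polynomials: an element `i` of `R` can be given a colour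
without creating zeros above `ρ`. The quotients `Bⱼ / G`, where `G - k Bⱼ` are the candidates for
the next polynomial, are nonincreasing in all positive directions, so that a colour that works at
one point works at all larger points. -/
theorem exists_colour {p : MvPolynomial ι ℝ} (hst : IsStable p)
    (hp : ∀ i, MvPolynomial.pderiv i (MvPolynomial.pderiv i p) = 0) (hk : 0 < k) {ρ : ℝ}
    (c : ι → Fin k) {R : Finset ι} {i : ι} (hi : i ∉ R)
    (h : ∀ x : ι → ℝ, (∀ l, ρ < x l) →
      0 < mixedEval (colourProd p c (insert i R)) x (fun l => if l ∈ insert i R then 1 else 0)) :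
    ∃ j, ∀ x : ι → ℝ, (∀ l, ρ < x l) →
      0 < mixedEval (colourProd p (Function.update c i j) R) x
        (fun l => if l ∈ R then 1 else 0) := by
  set P : Fin k → MvPolynomial ι ℝ := fun j =>
    shift (fun l => if l ∉ insert i R ∧ c l = j then (k : ℝ) else 0) p with hP
  set Q := colourProd p c (insert i R) with hQ
  have hQP : Q = ∏ j, P j := rfl
  set q : Fin k → MvPolynomial ι ℝ := fun j =>
    MvPolynomial.pderiv i (P j) * ∏ l ∈ Finset.univ.erase j, P l with hq
  set y : ι → ℝ := fun l => if l ∈ R then 1 else 0 with hy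
  have hyi : y i = 0 := by simp [hy, hi]
  have hup : (fun l => if l ∈ insert i R then (1 : ℝ) else 0) = Function.update y i 1 := by
    ext l
    by_cases hl : l = i
    · subst hl; simp
    · simp [hl, hy]
  have hdQ : MvPolynomial.pderiv i Q = ∑ j, q j := by rw [hQP, pderiv_prod]
  have hF : ∀ x : ι → ℝ, (∀ l, ρ < x l) →
      0 < mixedEval Q x y - ∑ j, mixedEval (q j) x y := by
    intro x hx
    have := h x hx
    rwa [hup, mixedEval_update_of_eq_zero _ _ hyi, one_mul, hdQ, mixedEval_sum] at this
  have hG : ∀ x : ι → ℝ, (∀ l, ρ < x l) → 0 < mixedEval Q x y := by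
    intro x hx
    have key := eval_zero_pos_of_derivative_lt
      (q := lineP (mixed Q) (Sum.elim x y) (Sum.elim (Pi.single i 1) 0)) (fun s hs => by
        rw [eval_derivative_lineP_mixed, eval_lineP_mixed,
          Finset.sum_eq_single i (fun l _ hl => by simp [Pi.single_eq_of_ne hl]) (by simp),
          Pi.single_eq_same, one_mul, hdQ, mixedEval_sum]
        refine sub_pos.1 (hF _ fun l => ?_)
        have : (0 : ℝ) ≤ Pi.single (M := fun _ => ℝ) i 1 l := by
          by_cases hl : l = i
          · subst hl; simp
          · simp [Pi.single_eq_of_ne hl]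
        have := mul_nonneg hs this
        linarith [hx l])
    rw [eval_lineP_mixed] at key
    simpa using key
  have hPst : ∀ j, IsStable (P j) := fun j => isStable_shift hst _
  have hPaff : ∀ j, MvPolynomial.pderiv i (MvPolynomial.pderiv i (P j)) = 0 := fun j => by
    simp only [hP, pderiv_shift, hp]
    simp [shift]
  have hmono : ∀ j, ∀ x x' : ι → ℝ, (∀ l, ρ < x l) → (∀ l, x l < x' l) →
      mixedEval (q j) x' y / mixedEval Q x' y ≤ mixedEval (q j) x y / mixedEval Q x y := by
    intro j x x' hx hxx'
    have hanti := div_antitoneOn_of_derivative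
      (b := lineP (mixed (q j)) (Sum.elim x y) (Sum.elim (x' - x) 0))
      (γ := lineP (mixed Q) (Sum.elim x y) (Sum.elim (x' - x) 0))
      (derivative_mul_sub_le_zero fun z w hz hw => by
        rw [aeval_lineP_mixed, aeval_lineP_mixed, ← mixedEval_map (S := ℂ),
          ← mixedEval_map (S := ℂ) (q j)]
        have hC := mixedEval_C_mul (A := ℂ) w (MvPolynomial.map (algebraMap ℝ ℂ) (q j))
          (fun l => (x l : ℂ) + z * (x' - x) l) (fun l => (y l : ℂ))
        rw [Algebra.algebraMap_self, RingHom.id_apply] at hC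
        rw [← hC, ← mixedEval_add]
        refine mixedEval_ne_zero (fun Z hZ => ?_) _ _ (fun l => ?_) (by simp)
        · rw [map_add, map_mul, MvPolynomial.aeval_map_algebraMap,
            MvPolynomial.aeval_map_algebraMap, MvPolynomial.algHom_C, Algebra.algebraMap_self,
            RingHom.id_apply, hQP, hq, map_mul, map_prod, map_prod,
            ← Finset.mul_prod_erase _ _ (Finset.mem_univ j), ← mul_assoc, ← add_mul,
            ← aeval_add_single (hPaff j)]
          refine mul_ne_zero (hPst j _ fun l => ?_) (Finset.prod_ne_zero_iff.2 fun l _ =>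
            hPst l Z hZ)
          by_cases hl : l = i
          · subst hl; simpa using add_pos (hZ l) hw
          · simpa [Pi.single_eq_of_ne hl] using hZ l
        · have := mul_pos hz (sub_pos.2 (hxx' l))
          simpa [Complex.mul_im] using this) (fun s hs => by
        rw [eval_lineP_mixed]
        refine hG _ fun l => ?_
        have := mul_nonneg hs (sub_pos.2 (hxx' l)).le
        simp only [Pi.sub_apply]
        linarith [hx l])
    have := hanti (Set.mem_Ici.2 le_rfl) (Set.mem_Ici.2 zero_le_one) zero_le_one
    simpa [eval_lineP_mixed] using this
  have hcol : ∀ j x, mixedEval (colourProd p (Function.update c i j) R) x y =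
      mixedEval Q x y - k * mixedEval (q j) x y := by
    intro j x
    rw [colourProd_update hp c hi j, sub_eq_add_neg, ← neg_mul, ← map_neg, mixedEval_add,
      mixedEval_C_mul, Algebra.algebraMap_self, RingHom.id_apply]
    ring
  simp only [hcol]
  -- If every colour `j` fails at some point `xs j`, then by monotonicity every colour fails at a
  -- point below all of them, which contradicts the positivity of the sum of the candidates.
  by_contra! hcon
  choose xs hxs hfail using hcon
  have hbetween : ∀ l, ∃ t, ρ < t ∧ ∀ j, t < xs j l := by
    intro l
    have : ∀ᶠ t in 𝓝[>] ρ, ρ < t ∧ ∀ j, t < xs j l := by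
      refine (eventually_mem_nhdsWithin).and (eventually_all.2 fun j => ?_)
      filter_upwards [Ioo_mem_nhdsGT (hxs j l)] with t ht
      exact ht.2
    exact this.exists
  choose x hx hxlt using hbetween
  have hsum : 0 < ∑ j, (mixedEval Q x y - k * mixedEval (q j) x y) := by
    rw [Finset.sum_sub_distrib, Finset.sum_const, Finset.card_univ, Fintype.card_fin,
      nsmul_eq_mul, ← Finset.mul_sum, ← mul_sub]
    exact mul_pos (by exact_mod_cast hk) (hF x hx)
  obtain ⟨j, -, hj⟩ := Finset.exists_lt_of_sum_lt (s := Finset.univ) (f := fun _ : Fin k => (0 : ℝ))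
    (g := fun j => mixedEval Q x y - k * mixedEval (q j) x y)
    (by rw [Finset.sum_const_zero]; exact hsum)
  have h1 := hmono j x (xs j) hx fun l => hxlt l j
  have hGx := hG x hx
  have hGxs := hG (xs j) (hxs j)
  rw [div_le_div_iff₀ hGxs hGx] at h1
  have hk' : (0 : ℝ) < k := by exact_mod_cast hk
  have h2 := mul_le_mul_of_nonneg_left h1 hk'.le
  have h3 := hfail j
  nlinarith [mul_pos hGxs hj, mul_nonneg hGx.le (sub_nonneg.2 h3)]

/-- If the average `∏ᵢ (1 - ∂ᵢ) pᵏ` over all colourings is positive above `ρ`, then for some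
colouring none of the polynomials `p(x - k 1_{Sⱼ})` vanishes above `ρ`. -/
theorem exists_colouring {p : MvPolynomial ι ℝ} (hst : IsStable p)
    (hp : ∀ i, MvPolynomial.pderiv i (MvPolynomial.pderiv i p) = 0) (hk : 0 < k) {ρ : ℝ}
    (h : ∀ x : ι → ℝ, (∀ l, ρ < x l) → 0 < mixedEval (p ^ k) x (fun _ => 1)) :
    ∃ c : ι → Fin k, ∀ x : ι → ℝ, (∀ l, ρ < x l) → ∀ j,
      MvPolynomial.eval (fun l => x l - if c l = j then (k : ℝ) else 0) p ≠ 0 := by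
  have key : ∀ R : Finset ι, ∀ c : ι → Fin k, (∀ x : ι → ℝ, (∀ l, ρ < x l) →
      0 < mixedEval (colourProd p c R) x (fun l => if l ∈ R then 1 else 0)) →
      ∃ c' : ι → Fin k, ∀ x : ι → ℝ, (∀ l, ρ < x l) →
        0 < MvPolynomial.eval x (colourProd p c' ∅) := by
    intro R
    induction R using Finset.induction_on with
    | empty =>
      intro c hc
      refine ⟨c, fun x hx => ?_⟩
      rw [← mixedEval_zero_right_eq_eval]
      simpa [Pi.zero_def] using hc x hx
    | insert i R hi ih =>
      intro c hc
      obtain ⟨j, hj⟩ := exists_colour hst hp hk c hi hc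
      exact ih _ hj
  obtain ⟨c, hc⟩ := key Finset.univ (fun _ => ⟨0, hk⟩) (fun x hx => by
    have e : colourProd p (fun _ => (⟨0, hk⟩ : Fin k)) (Finset.univ : Finset ι) = p ^ k := by
      simp [colourProd, shift]
    rw [e]
    simpa using h x hx)
  refine ⟨c, fun x hx j => ?_⟩
  have h1 := (hc x hx).ne'
  rw [colourProd, map_prod, Finset.prod_ne_zero_iff] at h1
  have h2 := h1 j (Finset.mem_univ j)
  have e := aeval_shift (fun l => if l ∉ (∅ : Finset ι) ∧ c l = j then (k : ℝ) else 0) p x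
  rw [MvPolynomial.aeval_eq_eval, MvPolynomial.aeval_eq_eval] at e
  intro h3
  apply h2
  refine Eq.trans e ?_
  simpa using h3

end Selection

/-! ### Colourings for stable polynomials -/

theorem eval_const_mul {σ : Type*} {p : MvPolynomial σ ℝ} {d : ℕ} (hp : p.IsHomogeneous d)
    (s : ℝ) (x : σ → ℝ) :
    MvPolynomial.eval (fun l => s * x l) p = s ^ d * MvPolynomial.eval x p := by
  simpa [MvPolynomial.aeval_eq_eval] using aeval_smul_of_isHomogeneous hp s x

/-- A second derivative in a coordinate direction that vanishes at `(1, …, 1)` vanishes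
identically. -/
theorem pderiv_pderiv_eq_zero {ι : Type*} [Fintype ι] {p : MvPolynomial ι ℝ} {d : ℕ}
    (hp : IsPosHurwitz d p) {i : ι}
    (h : MvPolynomial.eval (fun _ => 1) (MvPolynomial.pderiv i (MvPolynomial.pderiv i p)) = 0) :
    MvPolynomial.pderiv i (MvPolynomial.pderiv i p) = 0 :=
  eq_zero_of_iteratedNonneg
    (iteratedNonneg_pderiv (iteratedNonneg_pderiv (iteratedNonneg_of_isPosHurwitz hp) i) i) h

section Core

variable {ι : Type*} [Fintype ι] [DecidableEq ι] {k d : ℕ} {p : MvPolynomial ι ℝ} {τ : ι → ℝ}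

/-- The first two derivatives in a coordinate direction of a polynomial that is affine along that
direction through `(1, …, 1)`. -/
theorem eval_pderiv_of_affine {i : ι} {a : ℝ}
    (h : ∀ s : ℝ, MvPolynomial.eval (fun l => 1 + s * Pi.single (M := fun _ => ℝ) i 1 l) p =
      1 + s * a) :
    MvPolynomial.eval (fun _ => 1) (MvPolynomial.pderiv i p) = a ∧
      MvPolynomial.eval (fun _ => 1) (MvPolynomial.pderiv i (MvPolynomial.pderiv i p)) = 0 := by
  have hD : ∀ f : MvPolynomial ι ℝ, derivative (lineP f (fun _ => (1 : ℝ)) (Pi.single i 1)) =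
      lineP (MvPolynomial.pderiv i f) (fun _ => (1 : ℝ)) (Pi.single i 1) := fun f => by
    rw [derivative_lineP, Finset.sum_eq_single i] <;> simp +contextual
  have h0 : lineP p (fun _ => (1 : ℝ)) (Pi.single i 1) = C 1 + C a * X := by
    refine Polynomial.funext fun s => ?_
    rw [eval_lineP, MvPolynomial.aeval_eq_eval]
    rw [h s]
    simp only [eval_add, eval_mul, eval_C, eval_X]
    ring
  have h1 := hD p
  rw [h0] at h1
  have h2 := hD (MvPolynomial.pderiv i p)
  rw [← h1] at h2
  have hev : ∀ f : MvPolynomial ι ℝ, (lineP f (fun _ => (1 : ℝ)) (Pi.single i 1)).eval 0 =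
      MvPolynomial.eval (fun _ => 1) f := fun f => by
    rw [eval_lineP, MvPolynomial.aeval_eq_eval]; simp
  rw [← hev, ← hev, ← h1, ← h2]
  simp

/-- The points `(c α 1, c eᵢ)` lie in the cone if `α` bounds the logarithmic derivative `∂ᵢ g / g`
at `(1, …, 1)`. -/
theorem inCone_const_update {g : MvPolynomial ι ℝ} {D : ℕ} (hg : g.IsHomogeneous (D + 1))
    (h1 : MvPolynomial.eval (fun _ => 1) g = 1) {i : ι} {α c : ℝ} (hα : 0 ≤ α) (hc : 0 ≤ c)
    (hi : MvPolynomial.eval (fun _ => 1) (MvPolynomial.pderiv i g) ≤ α) :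
    InCone g (fun _ => c * α) (Function.update 0 i c) := by
  intro t ht
  have hs : 0 < c * α + t := by positivity
  have hev : ∀ {f : MvPolynomial ι ℝ} {n : ℕ}, f.IsHomogeneous n →
      MvPolynomial.eval (fun _ : ι => c * α + t) f =
        (c * α + t) ^ n * MvPolynomial.eval (fun _ => 1) f := fun {f n} hf => by
    have := aeval_smul_of_isHomogeneous hf (c * α + t) (fun _ : ι => (1 : ℝ))
    simpa [MvPolynomial.aeval_eq_eval] using this
  rw [mixedEval_update_of_eq_zero _ _ (by simp), mixedEval_zero_right_eq_eval,
    mixedEval_zero_right_eq_eval, hev hg, hev hg.pderiv, h1, Nat.add_sub_cancel, pow_succ]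
  have : 0 < (c * α + t) - c * MvPolynomial.eval (fun _ => 1) (MvPolynomial.pderiv i g) := by
    nlinarith [mul_le_mul_of_nonneg_left hi hc]
  nlinarith [mul_pos (pow_pos hs D) this]

/-- The optimal barrier shift `q = √δ(α, m)` exceeds `1` if `m α ≥ 2`, and its quadratic equation
turns `(m c α + (m - 1) q) / (m - 1 + c)` with `c = q / (q - 1)` into `q²`. -/
theorem exists_sqrt_delta {α m : ℝ} (hm : 1 ≤ m) (hα : 2 ≤ m * α) :
    ∃ q : ℝ, (1 - 1 / m + Real.sqrt (α - 1 / m * (1 - 1 / m))) = q ∧ 1 < q ∧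
      m * α = (m - 1) * (q - 1) ^ 2 + q ^ 2 := by
  have hm0 : 0 < m := by linarith
  have hn : 0 < 1 / m := by positivity
  have hn1 : m * (1 / m) = 1 := by field_simp
  set n := 1 / m
  have hα' : 2 * n ≤ α := by nlinarith
  have hn2 : n ≤ 1 := by nlinarith
  have hr : n ^ 2 < α - n * (1 - n) := by nlinarith
  have h0 : 0 ≤ α - n * (1 - n) := (sq_nonneg n).trans hr.le
  have hs := Real.sq_sqrt h0
  have hlt : n < Real.sqrt (α - n * (1 - n)) := Real.lt_sqrt_of_sq_lt hr
  refine ⟨_, rfl, by linarith, ?_⟩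
  set w := Real.sqrt (α - n * (1 - n))
  have e : α = w ^ 2 + n * (1 - n) := by linarith
  rw [e]
  linear_combination (1 + 2 * w - 2 * n) * hn1


/-- The barrier argument makes `∏ᵢ (1 - ∂ᵢ) pᵏ` positive above `δ(kε, m)`. -/
theorem exists_colouring_of_normalised (hst : IsStable p) (hp : p.IsHomogeneous d) (hd : d ≠ 0)
    (h1 : MvPolynomial.eval (fun _ => 1) p = 1)
    (hτ : ∀ i (s : ℝ), MvPolynomial.eval (fun l => 1 + s * Pi.single (M := fun _ => ℝ) i 1 l) p =
      1 + s * τ i) (hk : 2 ≤ k) {ε : ℝ} (hε : ∀ i, τ i ≤ ε) :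
    ∃ c : ι → Fin k, ∀ x : ι → ℝ, (∀ l, delta (k * ε) (Fintype.card ι) < x l) → ∀ j,
      MvPolynomial.eval (fun l => x l - if c l = j then (k : ℝ) else 0) p ≠ 0 := by
  have hpos : IsPosHurwitz d p := isPosHurwitz_of_isStable hp hst (by rw [h1]; exact one_pos)
  have hk2 : (2 : ℝ) ≤ k := by exact_mod_cast hk
  -- By Euler's identity the `τᵢ` sum to the degree; so `m ε ≥ 1`, and hence `m k ε ≥ 2`.
  have hsum : ∑ i, τ i = d := by
    have := congrArg (MvPolynomial.eval (fun _ : ι => (1 : ℝ))) hp.sum_X_mul_pderiv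
    rw [map_sum, map_nsmul, h1] at this
    simpa [(eval_pderiv_of_affine (hτ _)).1] using this
  have hmε : 1 ≤ (Fintype.card ι : ℝ) * ε := by
    have h2 : ∑ i, τ i ≤ ∑ _i : ι, ε := Finset.sum_le_sum fun i _ => hε i
    have h3 : (1 : ℝ) ≤ d := by exact_mod_cast Nat.one_le_iff_ne_zero.2 hd
    rw [Finset.sum_const, Finset.card_univ, nsmul_eq_mul, hsum] at h2
    linarith
  have hne : Nonempty ι := by
    by_contra h
    rw [not_nonempty_iff, ← Fintype.card_eq_zero_iff] at h
    rw [h] at hmε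
    norm_num at hmε
  have hm : (1 : ℝ) ≤ Fintype.card ι := by exact_mod_cast Fintype.card_pos
  obtain ⟨q, hq, hq1, hqα⟩ := exists_sqrt_delta (α := k * ε) hm (by nlinarith)
  have hα : 0 ≤ (k : ℝ) * ε := by nlinarith
  have hδ : delta (k * ε) (Fintype.card ι) = q ^ 2 := by rw [delta, hq]
  have hg : IsPosHurwitz (d * k) (p ^ k) := by
    refine isPosHurwitz_of_isStable (hp.pow k) (fun z hz => ?_) (by simp [h1])
    rw [map_pow]
    exact pow_ne_zero _ (hst z hz)
  have hgst : IsStable (p ^ k) := fun z hz => by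
    rw [map_pow]
    exact pow_ne_zero _ (hst z hz)
  obtain ⟨D, hD⟩ := Nat.exists_eq_succ_of_ne_zero (n := d * k) (by positivity)
  have hc : q / (q - 1) * (q - 1) = q := div_mul_cancel₀ _ (by linarith)
  have hcone := inCone_average hg hgst hq1 hc fun i => inCone_const_update (D := D)
    (by simpa only [hD] using hg.homogeneous) (by simp [h1]) hα
    (div_pos (by linarith) (by linarith)).le (by
      rw [Derivation.leibniz_pow]
      simp only [h1, smul_eq_mul, nsmul_eq_mul, map_mul, map_pow, one_pow, map_natCast, one_mul,
        (eval_pderiv_of_affine (hτ i)).1]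
      exact mul_le_mul_of_nonneg_left (hε i) (by positivity))
  have hρ : ((Fintype.card ι : ℝ) * (q / (q - 1) * (k * ε)) + (Fintype.card ι - 1) * q) /
      (Fintype.card ι - 1 + q / (q - 1)) = q ^ 2 := by
    have h0 : q - 1 ≠ 0 := by linarith
    have h2 : 0 < q / (q - 1) := div_pos (by linarith) (by linarith)
    rw [div_eq_iff (by linarith)]
    field_simp
    linear_combination hqα
  rw [hρ] at hcone
  refine exists_colouring hst (fun i => pderiv_pderiv_eq_zero hpos
    (eval_pderiv_of_affine (hτ i)).2) (by omega) fun x hx => ?_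
  have hgap : ∃ t : ℝ, 0 < t ∧ ∀ l, delta (k * ε) (Fintype.card ι) + t ≤ x l := by
    have : ∀ᶠ t in 𝓝[>] (0 : ℝ), 0 < t ∧ ∀ l, delta (k * ε) (Fintype.card ι) + t ≤ x l := by
      refine eventually_mem_nhdsWithin.and (eventually_all.2 fun l => ?_)
      filter_upwards [Ioo_mem_nhdsGT (sub_pos.2 (hx l))] with t ht
      linarith [ht.2]
    exact this.exists
  obtain ⟨t, ht, hxt⟩ := hgap
  rw [hδ] at hxt
  exact hcone.pos hg hgst ht hxt

/-- Stable polynomials whose directional restrictions `s ↦ p(1 + s eᵢ)` are affine with small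
slope admit a colouring in which all zeros of `r ↦ p(r 1 - 1_{Sⱼ})` are small. -/
theorem exists_colouring_root_le (hst : IsStable p) (hp : p.IsHomogeneous d)
    (h1 : MvPolynomial.eval (fun _ => 1) p ≠ 0)
    (hτ : ∀ i (s : ℝ), MvPolynomial.eval (fun l => 1 + s * Pi.single (M := fun _ => ℝ) i 1 l) p =
      MvPolynomial.eval (fun _ => 1) p * (1 + s * τ i)) (hk : 2 ≤ k) {ε : ℝ} (hε : ∀ i, τ i ≤ ε) :
    ∃ c : ι → Fin k, ∀ j (r : ℝ),
      MvPolynomial.eval (fun l => r - if c l = j then 1 else 0) p = 0 →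
        |r| ≤ 1 / k * delta (k * ε) (Fintype.card ι) := by
  have hk0 : (0 : ℝ) < k := by exact_mod_cast (by omega : 0 < k)
  rcases eq_or_ne d 0 with rfl | hd
  · refine ⟨fun _ => ⟨0, by omega⟩, fun j r hr => ?_⟩
    obtain ⟨a, rfl⟩ : ∃ a, p = MvPolynomial.C a :=
      ⟨_, MvPolynomial.totalDegree_eq_zero_iff_eq_C.1 (Nat.le_zero.1 hp.totalDegree_le)⟩
    rw [MvPolynomial.eval_C] at hr h1
    exact absurd hr h1
  set a := MvPolynomial.eval (fun _ => 1) p with ha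
  have hst' : IsStable (MvPolynomial.C a⁻¹ * p) := fun z hz => by
    rw [map_mul, MvPolynomial.algHom_C]
    exact mul_ne_zero (by simpa using h1) (hst z hz)
  obtain ⟨c, hc⟩ := exists_colouring_of_normalised (τ := τ) hst'
    (by simpa using (MvPolynomial.isHomogeneous_C ι a⁻¹).mul hp) hd (by simp [← ha, h1])
    (fun i s => by
      rw [map_mul, hτ, MvPolynomial.eval_C, ← mul_assoc, inv_mul_cancel₀ h1, one_mul]) hk hε
  refine ⟨c, fun j r hr => ?_⟩
  -- For `r < 0` the point `1_{Sⱼ} - r 1` lies in the positive orthant, where `p` has no zeros.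
  have hr0 : 0 ≤ r := by
    by_contra! hneg
    have h2 := aeval_smul_of_isHomogeneous hp Complex.I
      (fun l => ((-r + if c l = j then 1 else 0 : ℝ) : ℂ))
    rw [aeval_ofReal] at h2
    have h3 := eval_const_mul hp (-1) (fun l => (r - if c l = j then 1 else 0 : ℝ))
    have h4 : MvPolynomial.eval (fun l => (-r + if c l = j then 1 else 0 : ℝ)) p = 0 := by
      rw [hr, mul_zero] at h3
      refine Eq.trans ?_ h3
      congr 2
      ext l
      ring
    rw [h4, Complex.ofReal_zero, mul_zero] at h2
    refine hst _ (fun l => ?_) h2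
    rw [Complex.I_mul_im, Complex.ofReal_re]
    split_ifs <;> linarith
  rw [abs_of_nonneg hr0]
  by_contra! hlt
  rw [one_div, inv_mul_lt_iff₀ hk0] at hlt
  refine hc (fun _ => k * r) (fun _ => hlt) j ?_
  have h3 := eval_const_mul hp k (fun l => (r - if c l = j then 1 else 0 : ℝ))
  rw [hr, mul_zero] at h3
  rw [map_mul]
  refine mul_eq_zero_of_right _ (Eq.trans ?_ h3)
  simp [mul_sub]

end Core

/-! ### Hyperbolic polynomials -/

section Hyperbolic

variable {σ : Type*} {h : MvPolynomial σ ℝ} {e : σ → ℝ}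

theorem linePoly_eq_lineP (h : MvPolynomial σ ℝ) (e x : σ → ℝ) :
    linePoly h e x = lineP h (fun l => -x l) e := by
  unfold linePoly lineP
  congr 2
  ext1 l
  rw [C_neg]
  ring

theorem eval_linePoly (h : MvPolynomial σ ℝ) (e x : σ → ℝ) (t : ℝ) :
    (linePoly h e x).eval t = MvPolynomial.eval (fun l => t * e l - x l) h := by
  rw [linePoly_eq_lineP, eval_lineP, MvPolynomial.aeval_eq_eval]
  congr 2
  ext1 l
  ring

theorem IsHyperbolic.natDegree_linePoly (hh : IsHyperbolic h e) {d : ℕ} (hd : h.IsHomogeneous d)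
    (x : σ → ℝ) : (linePoly h e x).natDegree = d ∧
      (linePoly h e x).leadingCoeff = MvPolynomial.eval e h := by
  obtain ⟨h1, h2⟩ := lineP_bound hd (fun l => -x l) e
  rw [MvPolynomial.aeval_eq_eval, ← linePoly_eq_lineP] at h2
  rw [← linePoly_eq_lineP] at h1
  have h3 : (linePoly h e x).natDegree = d :=
    natDegree_eq_of_le_of_coeff_ne_zero h1 (h2 ▸ hh.eval_ne_zero)
  exact ⟨h3, by rw [leadingCoeff, h3]; exact h2⟩

theorem IsHyperbolic.linePoly_ne_zero (hh : IsHyperbolic h e) (x : σ → ℝ) : linePoly h e x ≠ 0 := by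
  obtain ⟨d, hd⟩ := hh.homogeneous
  rw [← leadingCoeff_ne_zero, (hh.natDegree_linePoly hd x).2]
  exact hh.eval_ne_zero

theorem IsHyperbolic.splits_linePoly (hh : IsHyperbolic h e) (x : σ → ℝ) :
    (linePoly h e x).Splits := by
  refine Splits.of_splits_map (algebraMap ℝ ℂ) (IsAlgClosed.splits _) fun a ha => ?_
  rw [mem_roots (Polynomial.map_ne_zero (hh.linePoly_ne_zero x)), IsRoot.def,
    eval_map_algebraMap] at ha
  exact ⟨a.re, Complex.ext rfl (by simpa using (hh.real_rooted x a ha).symm)⟩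

/-- If at most one element of `M` is nonzero, only the linear part of `∏ (1 + s r)` survives. -/
theorem prod_map_one_add_of_card_le_one {M : Multiset ℝ} (s : ℝ)
    (hM : (M.filter (fun r => r ≠ 0)).card ≤ 1) : (M.map (fun r => 1 + s * r)).prod =
      1 + s * M.sum := by
  induction M using Multiset.induction_on with
  | empty => simp
  | cons a M ih =>
    by_cases ha : a = 0
    · subst ha
      simpa using ih (by simpa using hM)
    · have h0 : M.filter (fun r => r ≠ 0) = 0 := by
        rw [Multiset.filter_cons_of_pos (p := fun r => r ≠ 0) _ ha, Multiset.card_cons] at hM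
        exact Multiset.card_eq_zero.1 (by omega)
      have h1 : ∀ r ∈ M, r = 0 := fun r hr => by
        have := Multiset.filter_eq_nil.1 h0 r hr
        simpa using this
      have h2 : M.map (fun r => 1 + s * r) = M.map (fun _ => 1) :=
        Multiset.map_congr rfl fun r hr => by rw [h1 r hr]; ring
      rw [Multiset.map_cons, Multiset.prod_cons, Multiset.sum_cons, h2,
        Multiset.sum_eq_zero h1]
      simp

/-- Along the direction of a vector of rank at most one, `h` is affine with slope the trace. -/
theorem IsHyperbolic.eval_add_smul (hh : IsHyperbolic h e) {u : σ → ℝ} (hu : rank h e u ≤ 1)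
    (s : ℝ) : MvPolynomial.eval (fun l => e l + s * u l) h =
      MvPolynomial.eval e h * (1 + s * trace h e u) := by
  rcases eq_or_ne s 0 with rfl | hs
  · simp
  obtain ⟨d, hd⟩ := hh.homogeneous
  obtain ⟨hdeg, hlead⟩ := hh.natDegree_linePoly hd u
  have hspl := hh.splits_linePoly u
  have h1 := eval_linePoly h e u (-s⁻¹)
  rw [hspl.eval_eq_prod_roots, hlead] at h1
  have h2 := eval_const_mul hd (-s) (fun l => -s⁻¹ * e l - u l)
  have hcard := hspl.natDegree_eq_card_roots
  rw [hdeg] at hcard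
  have h3 : (fun l => -s * (-s⁻¹ * e l - u l)) = fun l => e l + s * u l := by
    ext l
    field_simp
    ring
  rw [h3, ← h1, hcard] at h2
  rw [h2, trace, ← prod_map_one_add_of_card_le_one s hu, eigenvalues, mul_left_comm,
    ← Multiset.prod_replicate, ← Multiset.map_const', ← Multiset.prod_map_mul]
  congr 3
  ext r
  field_simp
  ring_nf

theorem IsHyperbolic.eval_add_ne_zero (hh : IsHyperbolic h e) {u : σ → ℝ} (hu : u ∈ closedCone h e)
    {t : ℝ} (ht : 0 < t) : MvPolynomial.eval (fun l => t * e l + u l) h ≠ 0 := by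
  intro h0
  obtain ⟨d, hd⟩ := hh.homogeneous
  have h1 := eval_const_mul hd (-1) (fun l => t * e l + u l)
  have h2 := hu (-t) (by
    rw [eigenvalues, mem_roots (hh.linePoly_ne_zero u), IsRoot.def, eval_linePoly]
    rw [h0, mul_zero] at h1
    rw [← h1]
    congr 2
    ext l
    ring)
  linarith

theorem IsHyperbolic.aeval_ne_zero (hh : IsHyperbolic h e) (x : σ → ℝ) (z : ℂ) (hz : 0 < z.im) :
    MvPolynomial.aeval (fun l => (x l : ℂ) + z * e l) h ≠ 0 := by
  intro h0
  refine hz.ne' (hh.real_rooted (fun l => -x l) z ?_)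
  rw [linePoly_eq_lineP, aeval_lineP]
  simpa using h0

/-- The polynomial `(xᵢ) ↦ h(∑ᵢ xᵢ uᵢ)`. -/
noncomputable def pencil {ι : Type*} [Fintype ι] (h : MvPolynomial σ ℝ) (u : ι → σ → ℝ) :
    MvPolynomial ι ℝ :=
  MvPolynomial.aeval (fun l => ∑ i, MvPolynomial.C (u i l) * MvPolynomial.X i) h

section Pencil

variable {ι : Type*} [Fintype ι] {u : ι → σ → ℝ}

theorem aeval_pencil {A : Type*} [CommRing A] [Algebra ℝ A] (z : ι → A) :
    MvPolynomial.aeval z (pencil h u) =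
      MvPolynomial.aeval (fun l => ∑ i, z i * algebraMap ℝ A (u i l)) h := by
  rw [pencil, MvPolynomial.comp_aeval_apply]
  simp [MvPolynomial.algHom_C, mul_comm]

theorem eval_pencil (x : ι → ℝ) :
    MvPolynomial.eval x (pencil h u) = MvPolynomial.eval (fun l => ∑ i, x i * u i l) h := by
  have := aeval_pencil (h := h) (u := u) x
  simpa [MvPolynomial.aeval_eq_eval] using this

theorem isHomogeneous_pencil {d : ℕ} (hd : h.IsHomogeneous d) :
    (pencil h u).IsHomogeneous d := by
  have := MvPolynomial.IsHomogeneous.aeval hd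
    (fun l => ∑ i, MvPolynomial.C (u i l) * MvPolynomial.X (R := ℝ) i) (n := 1)
    fun l => MvPolynomial.IsHomogeneous.sum _ _ _ fun i _ =>
      MvPolynomial.isHomogeneous_C_mul_X _ _
  rwa [one_mul] at this

/-- For `τ > 0` below all `im zᵢ` one has `∑ zᵢ uᵢ = ∑ (zᵢ - iτ) uᵢ + iτ e`, and Gårding's theorem
applies. -/
theorem isStable_pencil (hh : IsHyperbolic h e) (hu : ∀ i, u i ∈ closedCone h e)
    (hsum : ∑ i, u i = e) : IsStable (pencil h u) := by
  intro z hz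
  obtain ⟨d, hd⟩ := hh.homogeneous
  have hgap : ∃ t : ℝ, 0 < t ∧ ∀ i, t ≤ (z i).im := by
    have : ∀ᶠ t in 𝓝[>] (0 : ℝ), 0 < t ∧ ∀ i, t ≤ (z i).im := by
      refine eventually_mem_nhdsWithin.and (eventually_all.2 fun i => ?_)
      filter_upwards [Ioo_mem_nhdsGT (hz i)] with t ht
      exact ht.2.le
    exact this.exists
  obtain ⟨t, ht, htz⟩ := hgap
  have := aeval_ne_zero_of_mem_cone hd e hh.aeval_ne_zero u
    (fun i s hs => hh.eval_add_ne_zero (hu i) hs) Finset.univ (fun _ => 0)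
    (fun i => z i - t * Complex.I) (t * Complex.I)
    (fun i _ => by simpa using htz i) (by simpa using ht)
  rw [aeval_pencil]
  refine fun h0 => this (Eq.trans (congrArg (fun w => MvPolynomial.aeval w h) ?_) h0)
  ext l
  rw [← hsum]
  simp [sub_mul, Finset.sum_sub_distrib, Finset.mul_sum]

end Pencil

theorem isPartition_fiber {m k : ℕ} (c : Fin m → Fin k) :
    IsPartition fun j => Finset.univ.filter fun i => c i = j := by
  refine ⟨fun a b hab => ?_, ?_⟩
  · rw [Finset.disjoint_left]
    rintro i ha hb
    simp only [Finset.mem_filter, Finset.mem_univ, true_and] at ha hb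
    exact hab (ha.symm.trans hb)
  · ext i
    simp

theorem delta_nonneg (α : ℝ) (m : ℕ) : 0 ≤ delta α m := sq_nonneg _

theorem IsHyperbolic.exists_partition {k m : ℕ} (hk : 2 ≤ k) {ε : ℝ} (hh : IsHyperbolic h e)
    {u : Fin m → σ → ℝ} (hu : ∀ i, u i ∈ closedCone h e) (hrank : ∀ i, rank h e (u i) ≤ 1)
    (htr : ∀ i, trace h e (u i) ≤ ε) (hsum : ∑ i, u i = e) :
    ∃ S : Fin k → Finset (Fin m), IsPartition S ∧
      ∀ j, specRadius h e (∑ i ∈ S j, u i) ≤ 1 / (k : ℝ) * delta (k * ε) m := by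
  obtain ⟨d, hd⟩ := hh.homogeneous
  have hsum' : ∀ l, ∑ i, u i l = e l := fun l => by rw [← hsum, Finset.sum_apply]
  have h1 : MvPolynomial.eval (fun _ => 1) (pencil h u) = MvPolynomial.eval e h := by
    rw [eval_pencil]
    simp [hsum']
  obtain ⟨c, hc⟩ := exists_colouring_root_le (p := pencil h u) (k := k)
    (τ := fun i => trace h e (u i)) (isStable_pencil hh hu hsum) (isHomogeneous_pencil hd)
    (h1 ▸ hh.eval_ne_zero) (fun i s => by
      rw [h1, eval_pencil, ← hh.eval_add_smul (hrank i)]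
      congr 2
      ext l
      simp [add_mul, Finset.sum_add_distrib, hsum', Pi.single_apply]) hk htr
  refine ⟨_, isPartition_fiber c, fun j => ?_⟩
  have hb : 0 ≤ 1 / (k : ℝ) * delta (k * ε) m := mul_nonneg (by positivity) (delta_nonneg _ _)
  rw [specRadius, ← Real.coe_toNNReal _ hb, NNReal.coe_le_coe, Multiset.sup_le]
  intro b hb'
  obtain ⟨r, hr, rfl⟩ := Multiset.mem_map.1 hb'
  rw [eigenvalues, mem_roots (hh.linePoly_ne_zero _), IsRoot.def, eval_linePoly] at hr
  have := hc j r (by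
    rw [eval_pencil]
    refine Eq.trans (congrArg (fun w => MvPolynomial.eval w h) ?_) hr
    ext l
    simp [sub_mul, Finset.sum_sub_distrib, Finset.sum_filter, ← Finset.mul_sum, hsum'])
  rw [Fintype.card_fin, ← Real.norm_eq_abs] at this
  exact NNReal.le_toNNReal_of_coe_le this

end Hyperbolic

theorem delta_lt (α : ℝ) {m : ℕ} (hm : 0 < m) :
    delta α m < (1 + Real.sqrt α) ^ 2 := by
  have hm1 : (1 : ℝ) ≤ m := by exact_mod_cast hm
  have h0 : 0 < 1 / (m : ℝ) := by positivity
  have h1 : 1 / (m : ℝ) ≤ 1 := by rw [div_le_one (by linarith)]; exact hm1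
  have h2 : Real.sqrt (α - 1 / (m : ℝ) * (1 - 1 / (m : ℝ))) ≤ Real.sqrt α :=
    Real.sqrt_le_sqrt (by nlinarith)
  unfold delta
  have h3 := Real.sqrt_nonneg (α - 1 / (m : ℝ) * (1 - 1 / (m : ℝ)))
  exact pow_lt_pow_left₀ (by linarith) (by linarith) two_ne_zero

/-! ### Sums of rank one matrices -/

section Determinant

open scoped Matrix

variable {m d : ℕ} {v : Fin m → EuclideanSpace ℂ (Fin d)}

theorem outer_eq_vecMulVec (w : EuclideanSpace ℂ (Fin d)) :
    outer w = Matrix.vecMulVec (fun a => w a) (star fun a => w a) := rfl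

theorem isHermitian_outer (w : EuclideanSpace ℂ (Fin d)) : (outer w).IsHermitian := by
  ext a b
  simp [outer, mul_comm]

theorem det_one_add_smul_outer (w : EuclideanSpace ℂ (Fin d)) (s : ℂ) :
    (1 + s • outer w).det = 1 + s * (‖w‖ ^ 2 : ℝ) := by
  have : s • outer w = Matrix.replicateCol Unit (fun a => s * w a) *
      Matrix.replicateRow Unit (star fun a => w a) := by
    ext a b
    simp [outer, Matrix.mul_apply, mul_assoc]
  rw [this, Matrix.det_one_add_replicateCol_mul_replicateRow, EuclideanSpace.norm_sq_eq]
  simp [dotProduct, Finset.mul_sum, Complex.normSq_eq_conj_mul_self, ← Complex.normSq_eq_norm_sq]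
  exact Finset.sum_congr rfl fun _ _ => by ring

/-- The determinantal polynomial `(xᵢ) ↦ det (∑ᵢ xᵢ vᵢ vᵢ*)`. -/
noncomputable def detPencil (v : Fin m → EuclideanSpace ℂ (Fin d)) : MvPolynomial (Fin m) ℂ :=
  (Matrix.of fun a b => ∑ i, MvPolynomial.C (outer (v i) a b) * MvPolynomial.X i).det

theorem eval_detPencil (z : Fin m → ℂ) :
    MvPolynomial.eval z (detPencil v) = (∑ i, z i • outer (v i)).det := by
  rw [detPencil, RingHom.map_det]
  congr 1
  ext a b
  simp [Matrix.sum_apply, mul_comm]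

theorem isHomogeneous_detPencil : (detPencil v).IsHomogeneous d := by
  rw [detPencil, Matrix.det_apply']
  refine MvPolynomial.IsHomogeneous.sum _ _ _ fun s _ => ?_
  have h1 := MvPolynomial.IsHomogeneous.prod Finset.univ
    (fun a : Fin d => ∑ i, MvPolynomial.C (outer (v i) (s a) a) * MvPolynomial.X i) (fun _ => 1)
    fun a _ => MvPolynomial.IsHomogeneous.sum _ _ _ fun i _ =>
      MvPolynomial.isHomogeneous_C_mul_X _ _
  have h2 := (MvPolynomial.isHomogeneous_C (Fin m) ((Equiv.Perm.sign s : ℤ) : ℂ)).mul h1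
  simpa using h2

/-- The coefficients of the determinantal polynomial are real: conjugating them transposes the
matrix. -/
theorem exists_real_detPencil (v : Fin m → EuclideanSpace ℂ (Fin d)) :
    ∃ p : MvPolynomial (Fin m) ℝ, MvPolynomial.map Complex.ofRealHom p = detPencil v := by
  have hconj : MvPolynomial.map (starRingEnd ℂ) (detPencil v) = detPencil v := by
    rw [detPencil, RingHom.map_det, ← Matrix.det_transpose]
    congr 1
    ext1 a b
    simp [outer, mul_comm]
  change detPencil v ∈ Set.range (MvPolynomial.map Complex.ofRealHom)
  rw [MvPolynomial.mem_range_map_iff_coeffs_subset]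
  intro c hc
  obtain ⟨n, -, rfl⟩ := MvPolynomial.mem_coeffs_iff.1 hc
  have h1 : (starRingEnd ℂ) ((detPencil v).coeff n) = (detPencil v).coeff n := by
    rw [← MvPolynomial.coeff_map, hconj]
  exact ⟨_, Complex.conj_eq_iff_re.1 h1⟩

/-- If `x` is in the kernel of `∑ᵢ zᵢ vᵢ vᵢ*`, then `∑ᵢ zᵢ |⟨vᵢ, x⟩|² = 0`; taking imaginary parts,
all `⟨vᵢ, x⟩` vanish, and `x = ∑ᵢ vᵢ vᵢ* x = 0`. -/
theorem det_sum_smul_outer_ne_zero (hv : ∑ i, outer (v i) = 1) {z : Fin m → ℂ}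
    (hz : ∀ i, 0 < (z i).im) : (∑ i, z i • outer (v i)).det ≠ 0 := by
  intro h0
  obtain ⟨x, hx, hx0⟩ := Matrix.exists_mulVec_eq_zero_iff.2 h0
  have key : ∀ i, outer (v i) *ᵥ x = (star (fun a => v i a) ⬝ᵥ x) • fun a => v i a := fun i => by
    rw [outer_eq_vecMulVec, Matrix.vecMulVec_mulVec, op_smul_eq_smul]
  have hform : ∑ i, z i * Complex.normSq (star (fun a => v i a) ⬝ᵥ x) = 0 := by
    have h1 := congrArg (fun y => star x ⬝ᵥ y) hx0
    simp only [Matrix.sum_mulVec, Matrix.smul_mulVec, dotProduct_sum, key, dotProduct_smul,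
      dotProduct_zero, smul_eq_mul] at h1
    rw [← h1]
    refine Finset.sum_congr rfl fun i _ => ?_
    rw [Complex.normSq_eq_conj_mul_self, starRingEnd_apply, Matrix.star_dotProduct, star_star]
    ring
  have him := congrArg Complex.im hform
  simp only [Complex.im_sum, Complex.im_mul_ofReal, Complex.zero_im] at him
  have h2 : ∀ i, star (fun a => v i a) ⬝ᵥ x = 0 := fun i => by
    have := (Finset.sum_eq_zero_iff_of_nonneg fun i _ =>
      mul_nonneg (hz i).le (Complex.normSq_nonneg _)).1 him i (Finset.mem_univ i)
    exact Complex.normSq_eq_zero.1 ((mul_eq_zero.1 this).resolve_left (hz i).ne')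
  apply hx
  have h3 := congrArg (fun M => M *ᵥ x) hv
  simp only [Matrix.sum_mulVec, key, h2, zero_smul, Finset.sum_const_zero, Matrix.one_mulVec] at h3
  exact h3.symm

/-- The operator norm of a Hermitian matrix is bounded by its real eigenvalues. -/
theorem opNorm_le_of_isHermitian {A : Matrix (Fin d) (Fin d) ℂ} (hA : A.IsHermitian) {ρ : ℝ}
    (hρ : 0 ≤ ρ) (h : ∀ r : ℝ, ((r : ℂ) • (1 : Matrix (Fin d) (Fin d) ℂ) - A).det = 0 → |r| ≤ ρ) :
    opNorm A ≤ ρ := by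
  set T := Matrix.toEuclideanCLM (n := Fin d) (𝕜 := ℂ) A with hT
  have hsa : IsSelfAdjoint T :=
    IsSelfAdjoint.map (f := Matrix.toEuclideanCLM (n := Fin d) (𝕜 := ℂ)) hA
  have hrad : spectralRadius ℂ T ≤ ENNReal.ofReal ρ := by
    refine iSup₂_le fun z hz => ?_
    have hre := hsa.mem_spectrum_eq_re hz
    rw [hT, AlgEquiv.spectrum_eq, spectrum.mem_iff, Matrix.isUnit_iff_isUnit_det,
      isUnit_iff_ne_zero, not_not, hre, Algebra.algebraMap_eq_smul_one] at hz
    have := h _ hz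
    rw [hre, ← enorm_eq_nnnorm, ← ofReal_norm, Complex.norm_real]
    exact ENNReal.ofReal_le_ofReal this
  rw [hsa.spectralRadius_eq_nnnorm] at hrad
  rw [opNorm, ← hT]
  rwa [← enorm_eq_nnnorm, ← ofReal_norm, ENNReal.ofReal_le_ofReal_iff hρ] at hrad

theorem exists_partition_opNorm {k : ℕ} (hk : 2 ≤ k) {ε : ℝ} (hv : ∑ i, outer (v i) = 1)
    (hε : ∀ i, ‖v i‖ ^ 2 ≤ ε) :
    ∃ S : Fin k → Finset (Fin m), IsPartition S ∧
      ∀ j, opNorm (∑ i ∈ S j, outer (v i)) ≤ 1 / (k : ℝ) * delta (k * ε) m := by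
  obtain ⟨p, hp⟩ := exists_real_detPencil v
  have haeval : ∀ z : Fin m → ℂ, MvPolynomial.aeval z p = (∑ i, z i • outer (v i)).det := by
    intro z
    rw [← eval_detPencil, ← hp, MvPolynomial.eval_map]
    rfl
  have heval : ∀ x : Fin m → ℝ, (MvPolynomial.eval x p : ℂ) =
      (∑ i, (x i : ℂ) • outer (v i)).det := fun x => by rw [← aeval_ofReal, haeval]
  have h1 : MvPolynomial.eval (fun _ => 1) p = 1 := by
    have := heval fun _ => 1
    simpa [hv] using this
  have hhom : p.IsHomogeneous d := by
    refine MvPolynomial.IsHomogeneous.of_map Complex.ofRealHom.injective ?_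
    rw [hp]
    exact isHomogeneous_detPencil
  obtain ⟨c, hc⟩ := exists_colouring_root_le (p := p) (k := k) (τ := fun i => ‖v i‖ ^ 2)
    (fun z hz => haeval z ▸ det_sum_smul_outer_ne_zero hv hz) hhom (by rw [h1]; exact one_ne_zero)
    (fun i s => by
      rw [h1, one_mul]
      apply Complex.ofReal_injective
      rw [heval]
      have := det_one_add_smul_outer (v i) s
      simp only [Complex.ofReal_add, Complex.ofReal_one, Complex.ofReal_mul, add_smul, one_smul,
        Finset.sum_add_distrib, hv]
      rw [Finset.sum_eq_single i]
      · simpa using this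
      · intro j _ hj
        simp [hj]
      · simp) hk hε
  refine ⟨_, isPartition_fiber c, fun j => opNorm_le_of_isHermitian ?_ ?_ fun r hr => ?_⟩
  · exact isSelfAdjoint_sum _ fun i _ => isHermitian_outer _
  · exact mul_nonneg (by positivity) (delta_nonneg _ _)
  · rw [← Fintype.card_fin m]
    refine hc j r ?_
    apply Complex.ofReal_injective
    rw [heval, Complex.ofReal_zero, ← hr, ← hv]
    congr 1
    simp [sub_smul, Finset.sum_sub_distrib, Finset.sum_filter, Finset.smul_sum, ite_smul]

end Determinant

end HyperbolicMSS

theorem theorem1p3 (k : ℕ) (hk : 2 ≤ k) (ε : ℝ) (hε : 0 < ε) (m : ℕ) :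
    -- the theorem for hyperbolic polynomials
    (∀ (n : ℕ) (h : MvPolynomial (Fin n) ℝ) (e : Fin n → ℝ) (u : Fin m → Fin n → ℝ),
      HyperbolicMSS.IsHyperbolic h e →
      (∀ i, u i ∈ HyperbolicMSS.closedCone h e) →
      (∀ i, HyperbolicMSS.rank h e (u i) ≤ 1) →
      (∀ i, HyperbolicMSS.trace h e (u i) ≤ ε) →
      ∑ i, u i = e →
      ∃ S : Fin k → Finset (Fin m), HyperbolicMSS.IsPartition S ∧
        ∀ j, HyperbolicMSS.specRadius h e (∑ i ∈ S j, u i) ≤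
          1 / (k : ℝ) * HyperbolicMSS.delta (k * ε) m) ∧
    -- the case of the determinant: the sharpened Marcus-Spielman-Srivastava theorem
    (∀ (d : ℕ) (v : Fin m → EuclideanSpace ℂ (Fin d)),
      ∑ i, HyperbolicMSS.outer (v i) = 1 →
      (∀ i, ‖v i‖ ^ 2 ≤ ε) →
      ∃ S : Fin k → Finset (Fin m), HyperbolicMSS.IsPartition S ∧
        ∀ j, HyperbolicMSS.opNorm (∑ i ∈ S j, HyperbolicMSS.outer (v i)) ≤
          1 / (k : ℝ) * HyperbolicMSS.delta (k * ε) m) ∧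
    -- its bound is smaller than the original one
    (0 < m → HyperbolicMSS.delta (k * ε) m < (1 + Real.sqrt (k * ε)) ^ 2) := by
  exact ⟨fun _ _ _ _ hh hu hrank htr hsum => hh.exists_partition hk hu hrank htr hsum,
    fun _ _ hv hle => HyperbolicMSS.exists_partition_opNorm hk hv hle, HyperbolicMSS.delta_lt _⟩
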